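/- Let $a_n>0$ and $b_n\in\mathbb R$ ($n\in\mathbb Z_+=\{0,1,2,\dots\}$) satisfy, as $n\to\infty$, $$a_n=n^\sigma\bigl(1+\alpha n^{-1}+O(n^{-2})\bigr),\qquad b_n=2\gamma n^\sigma\bigl(1+\beta n^{-1}+O(n^{-2})\bigr),$$ where $\alpha,\beta,\gamma\in\mathbb R$, $|\gamma|=1$, $\sigma>3/2$ and $\tau:=2\beta-2\alpha+\sigma>0$. Put $\nu=-\operatorname{sgn}\gamma$, $\varrho=\min\{\sigma-3/2,1/2\}$ and $a_{-1}=1/2$. Let $J_0$ be the operator in $\ell^2(\mathbb Z_+)$, defined on the vectors with finitely many non-zero components, by $(J_0u)_n=a_{n-1}u_{n-1}+b_nu_n+a_nu_{n+1}$ (with $u_{-1}=0$), and let $J=\operatorname{clos}J_0$ be its closure. Let $e_0,e_1,\dots$ be the canonical basis of $\ell^2(\mathbb Z_+)$, with the inner product $(\cdot,\cdot)$ linear in the first argument. Consider the Jacobi equation $$a_{n-1}y_{n-1}+b_ny_n+a_ny_{n+1}=zy_n,\qquad n\in\mathbb Z_+,\ z\in\mathbb C. \qquad (*)$$ Let $P_n(z)$,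 $n\ge -1$, be its solution with $P_{-1}(z)=0$, $P_0(z)=1$ (the orthogonal polynomials). For solutions $y,w$ of $(*)$ let $W[y,w]=a_n(y_nw_{n+1}-y_{n+1}w_n)$ be their Wronskian; it does not depend on $n\ge-1$. Then $J$ is self-adjoint, and for each $z\in\mathbb C$ there is exactly one solution $\{f_n(z)\}_{n\ge-1}$ of $(*)$ (the Jost solution) such that $$f_n(z)=\nu^n n^{-\sigma/2+1/4}e^{-2\sqrt{\tau n}}\bigl(1+O(n^{-\varrho})\bigr),\qquad n\to\infty.$$ All functions $f_n(z)$, $n\ge -1$, and in particular the Jost function $\Omega(z):=-\tfrac12 f_{-1}(z)=W[P(z),f(z)]$, are entire. Moreover: 1. If $\Omega(z)\ne0$ (by part 2 this holds for all $z$ with $\operatorname{Im}z\neq0$), then $J-z$ has a bounded inverse on $\ell^2(\mathbb Z_+)$, and for $n\le m$ $$\bigl((J-z)^{-1}e_n,e_m\bigr)=\Omega(z)^{-1}P_n(z)f_m(z),\qquad \bigl((J-z)^{-1}e_m,e_n\bigr)=\bigl((J-z)^{-1}e_n,e_m\bigr).$$ 2. The spectrum of $J$ is discrete, that is, it consists of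 isolated eigenvalues of finite multiplicity. There is a sequence of distinct real numbers $\lambda_1,\lambda_2,\dots$ such that the spectrum of $J$, the set of the eigenvalues of $J$ and the set of the zeros of $\Omega$ in $\mathbb C$ are all equal to $\{\lambda_1,\lambda_2,\dots\}$. 3. The operator-valued function $z\mapsto(J-z)^{-1}$ is analytic on $\mathbb C\setminus\{\lambda_1,\lambda_2,\dots\}$ and meromorphic on $\mathbb C$, and it has a pole at each of the points $\lambda_k$. -/

import Mathlib

open Filter Asymptotics Topology

namespace CriticalJacobi

noncomputable section

/-! ### Unbounded operators: resolvent set, resolvent, spectrum, eigenvalues -/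

section Operators

variable {H : Type*} [NormedAddCommGroup H] [InnerProductSpace ℂ H]

/-- The bounded operator `R` is the two-sided inverse of `T - z : dom T → H`. -/
def IsResolventAt (T : H →ₗ.[ℂ] H) (z : ℂ) (R : H →L[ℂ] H) : Prop :=
  (∀ y : H, ∃ h : R y ∈ T.domain, T ⟨R y, h⟩ - z • R y = y) ∧
    ∀ x : T.domain, R (T x - z • (x : H)) = x

/-- The set of all `z` such that `T - z` has a bounded everywhere defined inverse. -/
def resolventSetOf (T : H →ₗ.[ℂ] H) : Set ℂ :=
  {z | ∃ R : H →L[ℂ] H, IsResolventAt T z R}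

/-- The spectrum of a (possibly unbounded) operator. -/
def spectrumOf (T : H →ₗ.[ℂ] H) : Set ℂ := (resolventSetOf T)ᶜ

open Classical in
/-- The resolvent `(T - z)⁻¹`; it has the value `0` for `z` in the spectrum. -/
def resolventOf (T : H →ₗ.[ℂ] H) (z : ℂ) : H →L[ℂ] H :=
  if h : ∃ R : H →L[ℂ] H, IsResolventAt T z R then h.choose else 0

/-- The space of all `u ∈ dom T` with `T u = μ u`. -/
def eigenspaceOf (T : H →ₗ.[ℂ] H) (μ : ℂ) : Submodule ℂ H :=
  T.graph.comap (LinearMap.prod LinearMap.id (μ • LinearMap.id))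

/-- `μ` is an eigenvalue of `T`. -/
def IsEigenvalueOf (T : H →ₗ.[ℂ] H) (μ : ℂ) : Prop := eigenspaceOf T μ ≠ ⊥

/-- The spectrum of `T` consists of isolated eigenvalues of finite multiplicity. -/
def HasDiscreteSpectrum (T : H →ₗ.[ℂ] H) : Prop :=
  ∀ μ ∈ spectrumOf T,
    (∃ U ∈ 𝓝 μ, U ∩ spectrumOf T = {μ}) ∧
      IsEigenvalueOf T μ ∧ FiniteDimensional ℂ (eigenspaceOf T μ)

end Operators

/-! ### The Jacobi operator -/

/-- The Hilbert space `ℓ²(ℤ₊)`. -/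
abbrev EllTwo : Type := lp (fun _ : ℕ => ℂ) 2

/-- The canonical basis vector `e_n`. -/
def basisVec (n : ℕ) : EllTwo := lp.single 2 n (1 : ℂ)

/-- The Jacobi matrix applied to a sequence `u`:
`b_0 u_0 + a_0 u_1` at `0` and `a_{n-1} u_{n-1} + b_n u_n + a_n u_{n+1}` at `n ≥ 1`. -/
def jacobiAction (a b : ℕ → ℝ) (u : ℕ → ℂ) : ℕ → ℂ
  | 0 => b 0 * u 0 + a 0 * u 1
  | n + 1 => a n * u n + b (n + 1) * u (n + 1) + a (n + 1) * u (n + 2)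

lemma jacobiAction_add (a b : ℕ → ℝ) (u v : ℕ → ℂ) :
    jacobiAction a b (u + v) = jacobiAction a b u + jacobiAction a b v := by
  funext n
  cases n <;> simp [jacobiAction] <;> ring

lemma jacobiAction_smul (a b : ℕ → ℝ) (c : ℂ) (u : ℕ → ℂ) :
    jacobiAction a b (c • u) = c • jacobiAction a b u := by
  funext n
  cases n <;> simp [jacobiAction] <;> ring

lemma jacobiAction_support_finite (a b : ℕ → ℝ) {u : ℕ → ℂ}
    (hu : (Function.support u).Finite) : (Function.support (jacobiAction a b u)).Finite := by
  obtain ⟨N, hN⟩ := hu.bddAbove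
  have h0 : ∀ n, N < n → u n = 0 := fun n hn => by
    by_contra h
    exact absurd (hN (Function.mem_support.mpr h)) (not_le.mpr hn)
  refine (Set.finite_Iic (N + 1)).subset fun n hn => ?_
  by_contra h
  have h' : N + 1 < n := not_le.mp h
  apply hn
  cases n with
  | zero => omega
  | succ k =>
    simp [jacobiAction, h0 k (by omega), h0 (k + 1) (by omega), h0 (k + 2) (by omega)]

lemma memlp_of_support_finite {u : ℕ → ℂ} (hu : (Function.support u).Finite) :
    Memℓp u 2 :=
  (memℓp_zero (E := fun _ : ℕ => ℂ) hu).of_exponent_ge zero_le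

/-- The vectors of `ℓ²(ℤ₊)` with only finitely many non-zero components. -/
def finiteVectors : Submodule ℂ EllTwo where
  carrier := {u | (Function.support (u : ℕ → ℂ)).Finite}
  zero_mem' := by
    change (Function.support (0 : ℕ → ℂ)).Finite
    simp
  add_mem' {u v} hu hv := by
    refine (Set.Finite.union hu hv).subset ?_
    rw [lp.coeFn_add]
    exact Function.support_add _ _
  smul_mem' c u hu := by
    refine Set.Finite.subset hu ?_
    rw [lp.coeFn_smul]
    exact Function.support_const_smul_subset c _

/-- The minimal Jacobi operator `J₀`, defined on the finite vectors. -/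
def minimalJacobi (a b : ℕ → ℝ) : EllTwo →ₗ.[ℂ] EllTwo where
  domain := finiteVectors
  toFun :=
    { toFun := fun u =>
        ⟨jacobiAction a b (u : EllTwo),
          memlp_of_support_finite (jacobiAction_support_finite a b u.2)⟩
      map_add' := fun u v => by
        apply lp.ext
        exact jacobiAction_add a b (u : EllTwo) (v : EllTwo)
      map_smul' := fun c u => by
        apply lp.ext
        exact jacobiAction_smul a b c (u : EllTwo) }

/-- The Jacobi operator `J = clos J₀`. -/
def jacobiOperator (a b : ℕ → ℝ) : EllTwo →ₗ.[ℂ] EllTwo := (minimalJacobi a b).closure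

/-! ### The Jacobi difference equation

A sequence `(u_n)` with `n = -1, 0, 1, …` is stored as a function `u : ℕ → ℂ` shifted by one:
`u k` is the entry with index `k - 1`. -/

/-- The coefficients `a_{k-1}`, with `a_{-1} = 1/2`. -/
def shiftedCoeff (a : ℕ → ℝ) : ℕ → ℝ
  | 0 => 1 / 2
  | k + 1 => a k

/-- `a_{n-1} u_{n-1} + b_n u_n + a_n u_{n+1} = z u_n` for all `n ≥ 0` (sequences shifted). -/
def SolvesJacobi (a b : ℕ → ℝ) (z : ℂ) (u : ℕ → ℂ) : Prop :=
  ∀ n : ℕ, shiftedCoeff a n * u n + b n * u (n + 1) + a n * u (n + 2) = z * u (n + 1)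

/-- The orthogonal polynomials: `orthPoly a b z k` is `P_{k-1}(z)`, where `P_{-1} = 0`, `P_0 = 1`
and `a_{n-1} P_{n-1} + b_n P_n + a_n P_{n+1} = z P_n`. -/
def orthPoly (a b : ℕ → ℝ) (z : ℂ) : ℕ → ℂ
  | 0 => 0
  | 1 => 1
  | k + 2 => ((z - b k) * orthPoly a b z (k + 1) - shiftedCoeff a k * orthPoly a b z k) / a k

/-- The expression `a_n (u_n v_{n+1} - u_{n+1} v_n)` with `n = k - 1` (sequences shifted). -/
def wronskian (a : ℕ → ℝ) (u v : ℕ → ℂ) (k : ℕ) : ℂ :=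
  shiftedCoeff a k * (u k * v (k + 1) - u (k + 1) * v k)

/-- `ν^n n^{-σ/2 + 1/4} e^{-2 √(τ n)}` with `ν = - sgn γ`. -/
def ansatz (σ γ τ : ℝ) (n : ℕ) : ℝ :=
  (-Real.sign γ) ^ n * (n : ℝ) ^ (-σ / 2 + 1 / 4) * Real.exp (-2 * √(τ * n))

/-- For each `z`, the sequence `f z` (shifted) solves the Jacobi equation and
`f_n(z) = ν^n n^{-σ/2 + 1/4} e^{-2 √(τ n)} (1 + O(n^{-ϱ}))`, where `ϱ = min (σ - 3/2) (1/2)`. -/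
def IsJostSolution (a b : ℕ → ℝ) (σ γ τ : ℝ) (f : ℂ → ℕ → ℂ) : Prop :=
  ∀ z : ℂ, SolvesJacobi a b z (f z) ∧
    (fun n : ℕ => f z (n + 1) - (ansatz σ γ τ n : ℂ)) =O[atTop]
      fun n : ℕ => ansatz σ γ τ n * (n : ℝ) ^ (-min (σ - 3 / 2) (1 / 2))

/-- The Jost function `Ω(z) = - f_{-1}(z) / 2`. -/
def jostFunction (f : ℂ → ℕ → ℂ) (z : ℂ) : ℂ := -f z 0 / 2

end

end CriticalJacobi

open CriticalJacobi

namespace CriticalJacobi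

/-! ### Taylor expansions -/

/-! The ansatz `s n = ν^n n^(-σ/2+1/4) e^(-2√(τn))` nearly solves the Jacobi equation at `z = 0`.
Expand everything at `n + 1` in powers of `t = (n+1)^(-1/2)`, after dividing by `s (n+1) (n+1)^σ`:
the sign `ν` and the symmetry of the two neighbours cancel the orders `1` and `t`, the decay rate
`√τ` cancels `t²`, and the exponent `-σ/2 + 1/4` cancels `t³`. What remains is `O(n^(-2))`
(`residual_isBigO`); the term with `z` is treated as a perturbation too.

Write a solution as `f = s u`. Multiplied by `s (n+1)`, the equation becomes a second-order
difference equation for `u` in divergence form. With `q k = (a k s k s (k+1))⁻¹`, `r n` equal to `s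
(n+1)` times the residual, and `Q(i,j) = ∑_{k=i}^{j} q k`, summing it twice gives `u i = 1 - ∑_{j≥i}
Q(i,j) (r j - z s (j+1)²) u (j+1)`. The weight `E n = e^(4√(τn))` dominates `Q`, while `r j E (j+1)`
and `s j² E j` are `O(j^(-1-ϱ))`. Started far enough out, the equation is therefore solved by a
Neumann series in bounded sequences, analytically for `|z| < R`, and the tail sums give `u - 1 =
O(n^(-ϱ))` (`exists_jost_on_ball`). The recurrence supplies the finitely many missing entries. The
Wronskian of two decaying solutions vanishes, so the Jost solution is unique (`jost_unique`), and
the pieces for different `R` glue to entire functions (`exists_jost`).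

Variation of constants bounds every solution by `s E`. Hence the Green kernel `Ω⁻¹ P_min f_max` is
square summable and defines a Hilbert-Schmidt operator (`summable_sq_mul_sum_sq`,
`exists_hilbertSchmidt`). Its columns lie in the domain of `J`, and when `Ω(z) ≠ 0` no nonzero
vector of `ℓ²` solves the equation with the boundary condition, even pointwise. So the operator is
the resolvent (`exists_isResolventAt`), and since it also inverts the maximal operator, `J` is
self-adjoint.

If `Ω(z) = 0`, the Jost solution is an eigenvector, and symmetry makes `z` real. Thus `Ω(i) ≠ 0`,
the zeros of `Ω` are isolated, and they are exactly the spectrum. A finite spectrum would make a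
polynomial in the normal operator `(J - i)⁻¹` vanish and, the eigenspaces being finite-dimensional,
force the whole space to be finite-dimensional (`infinite_spectrumOf`). Normality also bounds the
resolvent by the inverse distance to the spectrum, so its singularities are poles
(`meromorphicAt_resolventOf`), and the eigenvectors prevent them from being removable. -/

lemma log_one_add_expansion :
    (fun y : ℝ => Real.log (1 + y) - y) =O[𝓝 0] fun y => y ^ 2 := by
  refine IsBigO.of_bound 2 ?_
  filter_upwards [Metric.ball_mem_nhds (0 : ℝ) (by norm_num : (0 : ℝ) < 1 / 2)] with y hy
  have hy' : |y| < 1 / 2 := by simpa using hy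
  have h := Real.abs_log_sub_add_sum_range_le (x := -y) (by rw [abs_neg]; linarith) 1
  simp only [Finset.sum_range_one, abs_neg, sub_neg_eq_add] at h
  norm_num at h
  rw [Real.norm_eq_abs, Real.norm_eq_abs, abs_of_nonneg (sq_nonneg y),
    show Real.log (1 + y) - y = -y + Real.log (1 + y) by ring]
  refine h.trans ?_
  rw [div_le_iff₀ (by linarith)]
  nlinarith [sq_nonneg y]

lemma isBigO_of_mul_continuous {f g : ℝ → ℝ} (h : ℝ → ℝ) (hc : ContinuousAt h 0)
    (hf : ∀ t, f t = h t * g t) : f =O[𝓝 0] g := by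
  have h1 : (fun t => h t * g t) =O[𝓝 0] fun t => (1 : ℝ) * g t :=
    (hc.tendsto.isBigO_one ℝ).mul (isBigO_refl g _)
  simpa [← hf] using h1

lemma one_add_rpow_expansion (c : ℝ) :
    (fun y : ℝ => (1 + y) ^ c - (1 + c * y)) =O[𝓝 0] fun y => y ^ 2 := by
  have h1 : (fun y : ℝ => Real.exp (c * Real.log (1 + y)) - (1 + c * Real.log (1 + y)))
      =O[𝓝 0] fun y => y ^ 2 := by
    have hlog : (fun y : ℝ => Real.log (1 + y)) =O[𝓝 0] fun y => y := by
      have := log_one_add_expansion.trans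
        (isBigO_of_mul_continuous (f := fun y : ℝ => y ^ 2) (g := fun y => y) (fun y => y)
          continuousAt_id (fun y => by ring))
      simpa using this.add (isBigO_refl (fun y : ℝ => y) _)
    have ht : Tendsto (fun y : ℝ => c * Real.log (1 + y)) (𝓝 0) (𝓝 0) := by
      have : ContinuousAt (fun y : ℝ => c * Real.log (1 + y)) 0 := by
        refine continuousAt_const.mul (ContinuousAt.log (by fun_prop) (by norm_num))
      simpa [ContinuousAt] using this
    have h2 := (Real.exp_sub_sum_range_isBigO_pow 2).comp_tendsto ht
    simp only [Finset.sum_range_succ, Finset.sum_range_zero] at h2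
    refine (h2.congr_left ?_).trans ?_
    · intro y; simp [Function.comp]
    · exact ((hlog.const_mul_left c).pow 2)
  have h3 := h1.add (log_one_add_expansion.const_mul_left c)
  refine h3.congr' ?_ EventuallyEq.rfl
  filter_upwards [Metric.ball_mem_nhds (0 : ℝ) (by norm_num : (0 : ℝ) < 1 / 2)] with y hy
  have hy' : |y| < 1 / 2 := by simpa using hy
  rw [Real.rpow_def_of_pos (by linarith [(abs_lt.mp hy').1]), mul_comm (Real.log _)]
  ring

/-- The ratio `A (x + ε) / A x`, where `A x = x ^ c * exp (-2 κ √x)`, as a function of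
`t = 1 / √x`. -/
noncomputable def ratioFun (c κ ε t : ℝ) : ℝ :=
  (1 + ε * t ^ 2) ^ c * Real.exp (-2 * ε * κ * (t / (1 + √(1 + ε * t ^ 2))))

lemma tendsto_mul_sq (ε : ℝ) : Tendsto (fun t : ℝ => ε * t ^ 2) (𝓝 0) (𝓝 0) := by
  have : Continuous fun t : ℝ => ε * t ^ 2 := by fun_prop
  simpa using this.tendsto 0

/-- With `√(1 + εt²) = 1 + εt²/2 + δ`, the error is exactly `t (t⁴/2 - (4 - εt²) δ) / (8 (1 + √(1 +
εt²)))`, and `δ = O(t⁴)`. -/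
lemma div_one_add_sqrt_expansion {ε : ℝ} (hε : ε ^ 2 = 1) :
    (fun t : ℝ => t / (1 + √(1 + ε * t ^ 2)) - (t / 2 - ε * t ^ 3 / 8)) =O[𝓝 0]
      fun t => t ^ 4 := by
  have h1 := ((one_add_rpow_expansion (1 / 2)).comp_tendsto (tendsto_mul_sq ε))
  have h2 : (fun t : ℝ => √(1 + ε * t ^ 2) - (1 + ε * t ^ 2 / 2)) =O[𝓝 0] fun t => t ^ 4 := by
    refine (h1.congr_left fun t => ?_).congr_right fun t => ?_
    · simp only [Function.comp, Real.sqrt_eq_rpow]; ring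
    · simp only [Function.comp, mul_pow, hε]; ring
  have hcont : Continuous fun t : ℝ => t / (8 * (1 + √(1 + ε * t ^ 2))) :=
    continuous_id.div (by fun_prop) fun t => by positivity
  have h3 : (fun t : ℝ => (t / (8 * (1 + √(1 + ε * t ^ 2)))) * (t ^ 4 / 2)) =O[𝓝 0]
      fun t => t ^ 4 :=
    isBigO_of_mul_continuous (fun t : ℝ => (t / (8 * (1 + √(1 + ε * t ^ 2)))) / 2)
      (hcont.div_const 2).continuousAt (fun t => by ring)
  have h4 : (fun t : ℝ => (-(t / (8 * (1 + √(1 + ε * t ^ 2)))) * (4 - ε * t ^ 2)) *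
      (√(1 + ε * t ^ 2) - (1 + ε * t ^ 2 / 2))) =O[𝓝 0] fun t => 1 * t ^ 4 := by
    refine IsBigO.mul ?_ h2
    have : Continuous fun t : ℝ => -(t / (8 * (1 + √(1 + ε * t ^ 2)))) * (4 - ε * t ^ 2) :=
      hcont.neg.mul (by fun_prop)
    exact (this.tendsto 0).isBigO_one ℝ
  have h5 := h3.add (h4.congr_right fun t => one_mul _)
  refine h5.congr_left fun t => ?_
  have hpos : (0 : ℝ) < 1 + √(1 + ε * t ^ 2) := by positivity
  generalize √(1 + ε * t ^ 2) = r at hpos ⊢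
  field_simp
  linear_combination (-t ^ 5) * hε

/-- The logarithm `G` of the ratio equals a cubic `p` up to `O(t⁴)`. Since `p = O(t)`, only the
first four terms of the exponential series matter. -/
lemma ratioFun_expansion (c κ : ℝ) {ε : ℝ} (hε : ε ^ 2 = 1) :
    (fun t : ℝ => ratioFun c κ ε t - (1 - ε * κ * t + (ε * c + κ ^ 2 / 2) * t ^ 2 +
      (κ / 4 - ε * κ ^ 3 / 6 - c * κ) * t ^ 3)) =O[𝓝 0] fun t => t ^ 4 := by
  set p : ℝ → ℝ := fun t => -ε * κ * t + ε * c * t ^ 2 + κ / 4 * t ^ 3 with hp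
  set G : ℝ → ℝ := fun t => c * Real.log (1 + ε * t ^ 2) +
    (-2 * ε * κ) * (t / (1 + √(1 + ε * t ^ 2))) with hG
  have hδ : (fun t => G t - p t) =O[𝓝 0] fun t => t ^ 4 := by
    have h1 := ((log_one_add_expansion.comp_tendsto (tendsto_mul_sq ε)).const_mul_left c)
    have h2 := (div_one_add_sqrt_expansion hε).const_mul_left (-2 * ε * κ)
    have h1' : (fun t : ℝ => c * (Real.log (1 + ε * t ^ 2) - ε * t ^ 2)) =O[𝓝 0]
        fun t => t ^ 4 := by
      refine (h1.congr_left fun t => ?_).congr_right fun t => ?_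
      · simp [Function.comp]
      · simp only [Function.comp, mul_pow, hε]; ring
    refine (h1'.add h2).congr_left fun t => ?_
    simp only [hG, hp]
    linear_combination (-κ * t ^ 3 / 4) * hε
  have hpc : Continuous p := by simp only [hp]; fun_prop
  have hp0 : p 0 = 0 := by simp [hp]
  have hpt : Tendsto p (𝓝 0) (𝓝 0) := by simpa [hp0] using hpc.tendsto 0
  have hδ0 : Tendsto (fun t => G t - p t) (𝓝 0) (𝓝 0) := by
    refine hδ.trans_tendsto ?_
    have : Continuous fun t : ℝ => t ^ 4 := by fun_prop
    simpa using this.tendsto 0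
  have h1 : (fun t => Real.exp (p t) * (Real.exp (G t - p t) - 1)) =O[𝓝 0] fun t => t ^ 4 := by
    have e1 : (fun t => Real.exp (p t)) =O[𝓝 0] fun _ => (1 : ℝ) :=
      ((Real.continuous_exp.comp hpc).tendsto 0).isBigO_one ℝ
    have e2 := ((Real.exp_sub_sum_range_isBigO_pow 1).comp_tendsto hδ0)
    have e3 : (fun t => Real.exp (G t - p t) - 1) =O[𝓝 0] fun t => t ^ 4 := by
      refine ((e2.congr_left fun t => ?_).congr_right fun t => ?_).trans hδ
      · simp [Function.comp]
      · simp [Function.comp]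
    simpa using e1.mul e3
  have h2 : (fun t => Real.exp (p t) - (1 + p t + p t ^ 2 / 2 + p t ^ 3 / 6)) =O[𝓝 0]
      fun t => t ^ 4 := by
    have e2 := ((Real.exp_sub_sum_range_isBigO_pow 4).comp_tendsto hpt)
    have e4 : (fun t => p t ^ 4) =O[𝓝 0] fun t => t ^ 4 :=
      isBigO_of_mul_continuous (fun t => (-ε * κ + ε * c * t + κ / 4 * t ^ 2) ^ 4)
        (by fun_prop) (fun t => by simp only [hp]; ring)
    refine (e2.congr_left fun t => ?_).trans e4
    simp only [Function.comp, Finset.sum_range_succ, Finset.sum_range_zero, Nat.factorial]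
    push_cast
    ring
  have h3 : (fun t => 1 + p t + p t ^ 2 / 2 + p t ^ 3 / 6 -
      (1 - ε * κ * t + (ε * c + κ ^ 2 / 2) * t ^ 2 +
      (κ / 4 - ε * κ ^ 3 / 6 - c * κ) * t ^ 3)) =O[𝓝 0] fun t => t ^ 4 := by
    -- This polynomial is the quotient by `t⁴` of the terms of degree at least four in `1 + p + p²/2
    -- + p³/6`, reduced with `ε² = 1`.
    refine isBigO_of_mul_continuous (fun t =>
      (c ^ 2 / 2 - ε * κ ^ 2 / 4 + ε * c * κ ^ 2 / 2)
      + (ε * c * κ / 4 - ε * κ * c ^ 2 / 2 + κ ^ 3 / 8) * t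
      + (κ ^ 2 / 32 + ε * c ^ 3 / 6 - c * κ ^ 2 / 4) * t ^ 2
      + (c ^ 2 * κ / 8 - ε * κ ^ 3 / 32) * t ^ 3 + ε * c * κ ^ 2 / 32 * t ^ 4
      + κ ^ 3 / 384 * t ^ 5) (by fun_prop) (fun t => ?_)
    have e3 : ε ^ 3 = ε := by rw [pow_succ, hε, one_mul]
    simp only [hp]
    ring_nf
    simp only [hε, e3]
    ring
  refine ((h1.add h2).add h3).congr' ?_ EventuallyEq.rfl
  filter_upwards [(tendsto_mul_sq ε).eventually (Metric.ball_mem_nhds (0 : ℝ)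
    (by norm_num : (0 : ℝ) < 1 / 2))] with t ht
  have hy' : |ε * t ^ 2| < 1 / 2 := by simpa using ht
  have hexp : ratioFun c κ ε t = Real.exp (G t) := by
    rw [ratioFun, Real.rpow_def_of_pos (by linarith [(abs_lt.mp hy').1]), ← Real.exp_add]
    congr 1
    simp only [hG]
    ring
  have : Real.exp (G t) = Real.exp (p t) * Real.exp (G t - p t) := by
    rw [← Real.exp_add]; congr 1; ring
  rw [hexp, this]
  ring

/-- The function `x ^ c * exp (-2 κ √x)`. -/
noncomputable def amplitude (c κ x : ℝ) : ℝ := x ^ c * Real.exp (-2 * κ * √x)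

lemma amplitude_pos (c κ : ℝ) {x : ℝ} (hx : 0 < x) : 0 < amplitude c κ x := by
  unfold amplitude; positivity

/-- Rationalising `√(x+ε) - √x = ε / (√x + √(x+ε))` gives an exponent that is smooth in `1/√x` at
zero. The case `x + ε = 0` is needed for the left neighbour of index `1`. -/
lemma amplitude_add (c κ : ℝ) {ε x : ℝ} (hx : 0 < x) (hε : 0 ≤ x + ε) :
    amplitude c κ (x + ε) = amplitude c κ x * ratioFun c κ ε (1 / √x) := by
  have hs : 0 < √x := Real.sqrt_pos.mpr hx
  have h1 : 1 + ε * (1 / √x) ^ 2 = (x + ε) / x := by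
    rw [div_pow, Real.sq_sqrt hx.le]; field_simp
  have h2 : √((x + ε) / x) = √(x + ε) / √x := Real.sqrt_div hε x
  unfold amplitude ratioFun
  rw [h1, h2, Real.div_rpow hε hx.le]
  have h3 : 1 / √x / (1 + √(x + ε) / √x) = 1 / (√x + √(x + ε)) := by field_simp
  have h4 : ε * (1 / (√x + √(x + ε))) = √(x + ε) - √x := by
    have : 0 < √x + √(x + ε) := by positivity
    field_simp
    nlinarith [Real.sq_sqrt hε, Real.sq_sqrt hx.le]
  rw [h3, show -2 * κ * √(x + ε) = -2 * κ * √x + -2 * ε * κ * (1 / (√x + √(x + ε))) by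
    linear_combination (2 * κ) * h4, Real.exp_add]
  have : x ^ c ≠ 0 := (Real.rpow_pos_of_pos hx c).ne'
  field_simp

/-! ### Asymptotics of the coefficients and of the ansatz -/

lemma ansatz_eq (σ γ τ : ℝ) (hτ : 0 ≤ τ) (n : ℕ) :
    ansatz σ γ τ n = (-Real.sign γ) ^ n * amplitude (-σ / 2 + 1 / 4) √τ n := by
  rw [ansatz, amplitude, Real.sqrt_mul hτ]
  ring_nf

lemma isBigO_mul_sub_mul {l : Filter ℕ} {f p F P g : ℕ → ℝ} (h1 : (fun n => f n - p n) =O[l] g)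
    (h2 : (fun n => F n - P n) =O[l] g) (hF : F =O[l] fun _ => (1 : ℝ))
    (hp : p =O[l] fun _ => (1 : ℝ)) : (fun n => f n * F n - p n * P n) =O[l] g := by
  have e1 := h1.mul hF
  have e2 := hp.mul h2
  simp only [mul_one, one_mul] at e1 e2
  exact (e1.add e2).congr_left fun n => by ring

lemma tendsto_one_div_sqrt : Tendsto (fun n : ℕ => 1 / √((n : ℝ) + 1)) atTop (𝓝 0) := by
  have h1 : Tendsto (fun n : ℕ => (n : ℝ) + 1) atTop atTop :=
    tendsto_atTop_add_const_right _ _ tendsto_natCast_atTop_atTop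
  simp only [one_div]
  exact (Real.tendsto_sqrt_atTop.comp h1).inv_tendsto_atTop

lemma one_div_sqrt_sq (n : ℕ) : (1 / √((n : ℝ) + 1)) ^ 2 = 1 / ((n : ℝ) + 1) := by
  rw [div_pow, Real.sq_sqrt (by positivity), one_pow]

lemma one_div_sqrt_pow_four (n : ℕ) : (1 / √((n : ℝ) + 1)) ^ 4 = (((n : ℝ) + 1) ^ 2)⁻¹ := by
  rw [show (4 : ℕ) = 2 * 2 from rfl, pow_mul, one_div_sqrt_sq, div_pow, one_pow, one_div]

lemma coeff_succ_expansion {a : ℕ → ℝ} {α σ : ℝ}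
    (haσ : (fun n : ℕ => a n / (n : ℝ) ^ σ - (1 + α / n)) =O[atTop]
      fun n : ℕ => ((n : ℝ) ^ 2)⁻¹) :
    (fun n : ℕ => a (n + 1) / ((n : ℝ) + 1) ^ σ - (1 + α * (1 / √((n : ℝ) + 1)) ^ 2)) =O[atTop]
      fun n : ℕ => (1 / √((n : ℝ) + 1)) ^ 4 := by
  refine ((haσ.comp_tendsto (tendsto_add_atTop_nat 1)).congr_left fun n => ?_).congr_right
    fun n => ?_
  · simp only [Function.comp]
    rw [one_div_sqrt_sq]
    push_cast
    ring
  · simp only [Function.comp]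
    rw [one_div_sqrt_pow_four]
    push_cast
    rfl

/-- Recentring at `n + 1` multiplies by `(n/(n+1))^σ = (1 - t²)^σ`, which shifts the second
coefficient from `α` to `α - σ`. -/
lemma coeff_expansion {a : ℕ → ℝ} {α σ : ℝ}
    (haσ : (fun n : ℕ => a n / (n : ℝ) ^ σ - (1 + α / n)) =O[atTop]
      fun n : ℕ => ((n : ℝ) ^ 2)⁻¹) :
    (fun n : ℕ => a n / ((n : ℝ) + 1) ^ σ - (1 + (α - σ) * (1 / √((n : ℝ) + 1)) ^ 2)) =O[atTop]
      fun n : ℕ => (1 / √((n : ℝ) + 1)) ^ 4 := by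
  have ht := tendsto_one_div_sqrt
  have hinv : (fun n : ℕ => ((n : ℝ) ^ 2)⁻¹) =O[atTop] fun n : ℕ => (1 / √((n : ℝ) + 1)) ^ 4 := by
    refine IsBigO.of_bound 4 ?_
    filter_upwards [eventually_ge_atTop 1] with n hn
    have hn' : (1 : ℝ) ≤ n := by exact_mod_cast hn
    rw [one_div_sqrt_pow_four, Real.norm_of_nonneg (by positivity),
      Real.norm_of_nonneg (by positivity), ← div_eq_mul_inv, inv_eq_one_div,
      div_le_div_iff₀ (by positivity) (by positivity)]
    nlinarith
  have h1 : (fun n : ℕ => a n / (n : ℝ) ^ σ - (1 + α * (1 / √((n : ℝ) + 1)) ^ 2)) =O[atTop]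
      fun n : ℕ => (1 / √((n : ℝ) + 1)) ^ 4 := by
    have e : (fun n : ℕ => α * (1 / (n : ℝ) - 1 / ((n : ℝ) + 1))) =O[atTop]
        fun n : ℕ => (1 / √((n : ℝ) + 1)) ^ 4 := by
      refine (IsBigO.trans ?_ hinv).const_mul_left α
      refine IsBigO.of_bound 1 ?_
      filter_upwards [eventually_ge_atTop 1] with n hn
      have hn' : (1 : ℝ) ≤ n := by exact_mod_cast hn
      have : 1 / (n : ℝ) - 1 / ((n : ℝ) + 1) = 1 / (n * (n + 1)) := by field_simp; ring
      rw [this, Real.norm_of_nonneg (by positivity), Real.norm_of_nonneg (by positivity), one_mul,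
        inv_eq_one_div, div_le_div_iff₀ (by positivity) (by positivity)]
      nlinarith
    refine ((haσ.trans hinv).add e).congr_left fun n => ?_
    rw [one_div_sqrt_sq]
    ring
  have h2 : (fun n : ℕ => ((n : ℝ) / (n + 1)) ^ σ - (1 - σ * (1 / √((n : ℝ) + 1)) ^ 2)) =O[atTop]
      fun n : ℕ => (1 / √((n : ℝ) + 1)) ^ 4 := by
    have := (one_add_rpow_expansion σ).comp_tendsto ((tendsto_mul_sq (-1)).comp ht)
    refine (this.congr_left fun n => ?_).congr_right fun n => ?_
    · simp only [Function.comp]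
      rw [show (1 : ℝ) + -1 * (1 / √((n : ℝ) + 1)) ^ 2 = n / (n + 1) by
        rw [one_div_sqrt_sq]; field_simp; ring]
      ring
    · simp only [Function.comp]
      ring
  have hO (r : ℝ) : (fun n : ℕ => 1 + r * (1 / √((n : ℝ) + 1)) ^ 2) =O[atTop]
      fun _ => (1 : ℝ) := by
    have hc : Continuous fun t : ℝ => 1 + r * t ^ 2 := by fun_prop
    exact ((hc.tendsto 0).comp ht).isBigO_one ℝ
  have ht4 : (fun n : ℕ => (1 / √((n : ℝ) + 1)) ^ 4) =O[atTop] fun _ => (1 : ℝ) := by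
    have hc : Continuous fun t : ℝ => t ^ 4 := by fun_prop
    exact ((hc.tendsto 0).comp ht).isBigO_one ℝ
  have h2O : (fun n : ℕ => ((n : ℝ) / (n + 1)) ^ σ) =O[atTop] fun _ => (1 : ℝ) := by
    refine ((h2.trans ht4).add (hO (-σ))).congr_left fun n => by ring
  have h3 := isBigO_mul_sub_mul h1 h2 h2O (hO α)
  have h4 : (fun n : ℕ => -(α * σ) * (1 / √((n : ℝ) + 1)) ^ 4) =O[atTop]
      fun n : ℕ => (1 / √((n : ℝ) + 1)) ^ 4 := (isBigO_refl _ _).const_mul_left _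
  refine (h3.add h4).congr' ?_ EventuallyEq.rfl
  filter_upwards [eventually_ge_atTop 1] with n hn
  have hn' : (0 : ℝ) < n := by exact_mod_cast hn
  have : a n / (n : ℝ) ^ σ * ((n : ℝ) / (n + 1)) ^ σ = a n / ((n : ℝ) + 1) ^ σ := by
    rw [Real.div_rpow hn'.le (by positivity)]
    have := (Real.rpow_pos_of_pos hn' σ).ne'
    field_simp
  rw [this]
  ring

/-- After division by the size of the middle term, the residual is a function of `t` whose expansion
starts at `t⁴`. This is where `τ` and the exponent in the ansatz come from. -/
lemma residual_isBigO {a b : ℕ → ℝ} {α β γ σ τ : ℝ} (hγ : |γ| = 1)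
    (haσ : (fun n : ℕ => a n / (n : ℝ) ^ σ - (1 + α / n)) =O[atTop]
      fun n : ℕ => ((n : ℝ) ^ 2)⁻¹)
    (hbσ : (fun n : ℕ => b n / (2 * γ * (n : ℝ) ^ σ) - (1 + β / n)) =O[atTop]
      fun n : ℕ => ((n : ℝ) ^ 2)⁻¹)
    (hτ : τ = 2 * β - 2 * α + σ) (hτ_pos : 0 < τ) :
    (fun n : ℕ => a n * ansatz σ γ τ n + b (n + 1) * ansatz σ γ τ (n + 1) +
      a (n + 1) * ansatz σ γ τ (n + 2)) =O[atTop]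
      fun n : ℕ => ansatz σ γ τ (n + 1) * ((n : ℝ) + 1) ^ σ * (((n : ℝ) + 1) ^ 2)⁻¹ := by
  set c : ℝ := -σ / 2 + 1 / 4 with hc
  set κ : ℝ := √τ with hκ
  have hκ2 : κ ^ 2 = τ := Real.sq_sqrt hτ_pos.le
  set t : ℕ → ℝ := fun n => 1 / √((n : ℝ) + 1) with htdef
  have ht : Tendsto t atTop (𝓝 0) := tendsto_one_div_sqrt
  have hγ2 : γ ^ 2 = 1 := by rw [← sq_abs, hγ, one_pow]
  have hγ0 : γ ≠ 0 := by intro h; simp [h] at hγ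
  have hsign : Real.sign γ = γ := by
    rcases eq_or_eq_neg_of_abs_eq hγ with h | h
    · rw [h, Real.sign_one]
    · rw [h, Real.sign_neg, Real.sign_one]
  have hO (g : ℝ → ℝ) (hg : Continuous g) : (fun n => g (t n)) =O[atTop] fun _ => (1 : ℝ) :=
    ((hg.tendsto 0).comp ht).isBigO_one ℝ
  have hP (ε : ℝ) (hε : ε ^ 2 = 1) := (ratioFun_expansion c κ hε).comp_tendsto ht
  have hF (ε : ℝ) (hε : ε ^ 2 = 1) : (fun n => ratioFun c κ ε (t n)) =O[atTop]
      fun _ => (1 : ℝ) := by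
    have h1 := (hP ε hε).trans (hO (fun t => t ^ 4) (by fun_prop))
    refine (h1.add (hO (fun t => 1 - ε * κ * t + (ε * c + κ ^ 2 / 2) * t ^ 2 +
      (κ / 4 - ε * κ ^ 3 / 6 - c * κ) * t ^ 3) (by fun_prop))).congr_left fun n => ?_
    simp only [Function.comp]
    ring
  have H1 := isBigO_mul_sub_mul (coeff_succ_expansion haσ) (hP 1 (by norm_num))
    (hF 1 (by norm_num)) (hO (fun t => 1 + α * t ^ 2) (by fun_prop))
  have H2 := isBigO_mul_sub_mul (coeff_expansion haσ) (hP (-1) (by norm_num))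
    (hF (-1) (by norm_num)) (hO (fun t => 1 + (α - σ) * t ^ 2) (by fun_prop))
  have H3 : (fun n : ℕ => γ * b (n + 1) / ((n : ℝ) + 1) ^ σ - 2 * (1 + β * t n ^ 2)) =O[atTop]
      fun n : ℕ => t n ^ 4 := by
    refine (((hbσ.comp_tendsto (tendsto_add_atTop_nat 1)).const_mul_left 2).congr_left
      fun n => ?_).congr_right fun n => ?_
    · simp only [Function.comp, htdef]
      rw [one_div_sqrt_sq]
      push_cast
      have : ((n : ℝ) + 1) ^ σ ≠ 0 := (Real.rpow_pos_of_pos (by positivity) σ).ne'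
      have h2 : b (n + 1) / (2 * γ * ((n : ℝ) + 1) ^ σ) =
          γ * b (n + 1) / ((n : ℝ) + 1) ^ σ / 2 := by
        rw [div_div, div_eq_div_iff (by positivity) (by positivity)]
        linear_combination (-2 * b (n + 1) * ((n : ℝ) + 1) ^ σ) * hγ2
      rw [h2]
      ring
    · simp only [Function.comp, htdef]
      rw [one_div_sqrt_pow_four]
      push_cast
      rfl
  -- The coefficient of `t²` is `κ² + 2α - σ - 2β = κ² - τ`, that of `t³` is `κ (1/2 - 2c - σ)`;
  -- both vanish. The orders `1` and `t` cancel between the neighbours and the diagonal term.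
  have H4 : (fun n : ℕ =>
      (1 + α * t n ^ 2) * (1 - 1 * κ * t n + (1 * c + κ ^ 2 / 2) * t n ^ 2 +
        (κ / 4 - 1 * κ ^ 3 / 6 - c * κ) * t n ^ 3) +
      (1 + (α - σ) * t n ^ 2) * (1 - (-1) * κ * t n + ((-1) * c + κ ^ 2 / 2) * t n ^ 2 +
        (κ / 4 - (-1) * κ ^ 3 / 6 - c * κ) * t n ^ 3) - 2 * (1 + β * t n ^ 2)) =O[atTop]
      fun n : ℕ => t n ^ 4 := by
    refine (isBigO_of_mul_continuous (f := fun t : ℝ =>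
      (1 + α * t ^ 2) * (1 - 1 * κ * t + (1 * c + κ ^ 2 / 2) * t ^ 2 +
        (κ / 4 - 1 * κ ^ 3 / 6 - c * κ) * t ^ 3) +
      (1 + (α - σ) * t ^ 2) * (1 - (-1) * κ * t + ((-1) * c + κ ^ 2 / 2) * t ^ 2 +
        (κ / 4 - (-1) * κ ^ 3 / 6 - c * κ) * t ^ 3) - 2 * (1 + β * t ^ 2))
      (g := fun t => t ^ 4) (fun t =>
      α * ((c + κ ^ 2 / 2) + (κ / 4 - κ ^ 3 / 6 - c * κ) * t) +
      (α - σ) * ((-c + κ ^ 2 / 2) + (κ / 4 + κ ^ 3 / 6 - c * κ) * t)) (by fun_prop)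
      (fun t => ?_)).comp_tendsto ht
    simp only [hc]
    linear_combination (t ^ 2) * hκ2 + (t ^ 2) * hτ
  have H5 : (fun n : ℕ => a (n + 1) / ((n : ℝ) + 1) ^ σ * ratioFun c κ 1 (t n) +
      a n / ((n : ℝ) + 1) ^ σ * ratioFun c κ (-1) (t n) - γ * b (n + 1) / ((n : ℝ) + 1) ^ σ)
      =O[atTop] fun n : ℕ => t n ^ 4 := by
    refine (((H1.add H2).sub H3).add H4).congr_left fun n => ?_
    simp only [htdef]
    ring
  refine IsBigO.trans ?_ ((isBigO_refl (fun n : ℕ => ansatz σ γ τ (n + 1) * ((n : ℝ) + 1) ^ σ)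
    atTop).mul (H5.congr_right fun n => one_div_sqrt_pow_four n))
  refine IsBigO.of_bound 1 (Eventually.of_forall fun n => le_of_eq ?_)
  have hx : (0 : ℝ) < (n : ℝ) + 1 := by positivity
  have e1 : amplitude c κ ((n + 2 : ℕ) : ℝ) =
      amplitude c κ ((n : ℝ) + 1) * ratioFun c κ 1 (t n) := by
    rw [← amplitude_add c κ hx (by positivity)]; push_cast; ring_nf
  have e2 : amplitude c κ (n : ℝ) =
      amplitude c κ ((n : ℝ) + 1) * ratioFun c κ (-1) (t n) := by
    rw [← amplitude_add c κ hx (by simp)]; ring_nf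
  have hpow : ((n : ℝ) + 1) ^ σ ≠ 0 := (Real.rpow_pos_of_pos hx σ).ne'
  have hnorm : ‖-γ‖ = 1 := by rw [norm_neg, Real.norm_eq_abs, hγ]
  -- The residual carries the sign of the neighbours `n` and `n + 2`, the comparison function that
  -- of `n + 1`; they differ by the factor `-γ` of modulus one.
  have hone (y : ℝ) : 1 * ‖y‖ = ‖(-γ) * y‖ := by rw [norm_mul, hnorm]
  rw [hone]
  congr 1
  simp only [ansatz_eq σ γ τ hτ_pos.le, hsign, ← hc, ← hκ]
  rw [e1, e2]
  push_cast
  simp only [pow_succ (-γ)]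
  field_simp
  linear_combination ((-γ) ^ n * amplitude c κ ((n : ℝ) + 1) *
    (γ * b (n + 1) - a n * ratioFun c κ (-1) (t n))) * hγ2

/-- A sequence `s` that solves the Jacobi equation up to a small residual and decays
superpolynomially; `E` is, up to powers of `n`, the sequence `s⁻²`. -/
structure IsDecayingAnsatz (a b s E : ℕ → ℝ) (ϱ : ℝ) : Prop where
  rate_pos : 0 < ϱ
  mono : Monotone E
  pos : ∀ n, 0 < E n
  ne_zero : ∀ n, 1 ≤ n → s n ≠ 0
  inv_bound : (fun k => (a k * s k * s (k + 1))⁻¹) =O[atTop] fun k => E (k + 1) - E k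
  residual_bound : (fun n => s (n + 1) * (a n * s n + b (n + 1) * s (n + 1) +
    a (n + 1) * s (n + 2)) * E (n + 1)) =O[atTop] fun n => ((n : ℝ) + 1) ^ (-1 - ϱ)
  sq_bound : (fun n => s n ^ 2 * E n) =O[atTop] fun n => (n : ℝ) ^ (-1 - ϱ)
  growth_bound : (fun k => s k ^ 2 * E k ^ 2) =O[atTop] fun k => E (k + 1) - E k
  succ_bound : (fun k => E (k + 1)) =O[atTop] E
  mul_tendsto : Tendsto (fun n => a n * s n) atTop (𝓝 0)
  mul_succ_tendsto : Tendsto (fun n => a n * s (n + 1)) atTop (𝓝 0)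

/-! ### Size estimates for the amplitude and its inverse square -/

lemma sqrt_succ_sub_le_one (x : ℝ) (hx : 0 ≤ x) : √(x + 1) - √x ≤ 1 := by
  have : √(x + 1) ≤ √x + 1 :=
    Real.sqrt_le_iff.mpr ⟨by positivity, by nlinarith [Real.sq_sqrt hx, Real.sqrt_nonneg x]⟩
  linarith

lemma amplitude_succ_ge {c κ : ℝ} (hc : c ≤ 0) (hκ : 0 ≤ κ) {x : ℝ} (hx : 1 ≤ x) :
    2 ^ c * Real.exp (-2 * κ) * amplitude c κ x ≤ amplitude c κ (x + 1) := by
  have h1 : (2 * x) ^ c ≤ (x + 1) ^ c :=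
    Real.rpow_le_rpow_of_nonpos (by positivity) (by linarith) hc
  rw [Real.mul_rpow (by norm_num) (by linarith)] at h1
  have h2 : Real.exp (-2 * κ) * Real.exp (-2 * κ * √x) ≤ Real.exp (-2 * κ * √(x + 1)) := by
    rw [← Real.exp_add]
    apply Real.exp_le_exp.mpr
    nlinarith [sqrt_succ_sub_le_one x (by linarith)]
  unfold amplitude
  calc 2 ^ c * Real.exp (-2 * κ) * (x ^ c * Real.exp (-2 * κ * √x))
      = (2 ^ c * x ^ c) * (Real.exp (-2 * κ) * Real.exp (-2 * κ * √x)) := by ring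
    _ ≤ _ := mul_le_mul h1 h2 (by positivity) (by positivity)

lemma amplitude_anti {c κ : ℝ} (hc : c ≤ 0) (hκ : 0 ≤ κ) {x : ℝ} (hx : 0 < x) :
    amplitude c κ (x + 1) ≤ amplitude c κ x := by
  refine mul_le_mul (Real.rpow_le_rpow_of_nonpos hx (by linarith) hc)
    (Real.exp_le_exp.mpr ?_) (by positivity) (by positivity)
  nlinarith [Real.sqrt_le_sqrt (show x ≤ x + 1 by linarith)]

/-- A discrete form of `d/dx e^(4κ√x) = 2κ x^(-1/2) e^(4κ√x)`, from `e^y ≥ 1 + y`. The `3` comes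
from `√x + √(x+1) ≤ 3√x`, valid for `x ≥ 1`. -/
lemma rpow_mul_exp_le_sub {κ : ℝ} (hκ : 0 < κ) {x : ℝ} (hx : 1 ≤ x) :
    x ^ (-(1 / 2) : ℝ) * Real.exp (4 * κ * √x) ≤
      3 / (4 * κ) * (Real.exp (4 * κ * √(x + 1)) - Real.exp (4 * κ * √x)) := by
  have hx0 : 0 < x := by linarith
  have hs : 0 < √x := Real.sqrt_pos.mpr hx0
  rw [Real.rpow_neg hx0.le, ← Real.sqrt_eq_rpow]
  have h2 : √(x + 1) ≤ 2 * √x := by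
    rw [Real.sqrt_le_left (by positivity), mul_pow, Real.sq_sqrt hx0.le]; linarith
  have h3 : (√(x + 1) - √x) * (3 * √x) ≥ 1 := by
    have h4 : √x ≤ √(x + 1) := Real.sqrt_le_sqrt (by linarith)
    nlinarith [Real.sq_sqrt hx0.le, Real.sq_sqrt (show 0 ≤ x + 1 by linarith)]
  have h5 : Real.exp (4 * κ * √(x + 1)) - Real.exp (4 * κ * √x) ≥
      Real.exp (4 * κ * √x) * (4 * κ * (√(x + 1) - √x)) := by
    rw [show 4 * κ * √(x + 1) = 4 * κ * √x + 4 * κ * (√(x + 1) - √x) by ring, Real.exp_add]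
    nlinarith [Real.add_one_le_exp (4 * κ * (√(x + 1) - √x)), Real.exp_pos (4 * κ * √x)]
  calc (√x)⁻¹ * Real.exp (4 * κ * √x)
      ≤ 3 / (4 * κ) * (Real.exp (4 * κ * √x) * (4 * κ * (√(x + 1) - √x))) := by
        rw [inv_mul_le_iff₀ hs]
        have : √x * (3 / (4 * κ) * (Real.exp (4 * κ * √x) * (4 * κ * (√(x + 1) - √x)))) =
          Real.exp (4 * κ * √x) * ((√(x + 1) - √x) * (3 * √x)) := by field_simp
        rw [this]
        nlinarith [Real.exp_pos (4 * κ * √x)]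
    _ ≤ _ := mul_le_mul_of_nonneg_left h5 (by positivity)

lemma amplitude_sq (c κ : ℝ) {x : ℝ} (hx : 0 < x) :
    amplitude c κ x ^ 2 * Real.exp (4 * κ * √x) = x ^ (2 * c) := by
  unfold amplitude
  rw [mul_pow, mul_assoc, ← Real.exp_nat_mul, ← Real.exp_add]
  push_cast
  rw [show 2 * (-2 * κ * √x) + 4 * κ * √x = 0 by ring, Real.exp_zero, mul_one,
    ← Real.rpow_natCast, ← Real.rpow_mul hx.le]
  push_cast
  ring_nf

lemma tendsto_rpow_mul_amplitude (σ c : ℝ) {κ : ℝ} (hκ : 0 < κ) :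
    Tendsto (fun n : ℕ => (n : ℝ) ^ σ * amplitude c κ n) atTop (𝓝 0) := by
  have h := (tendsto_rpow_mul_exp_neg_mul_atTop_nhds_zero (2 * (σ + c)) (2 * κ)
    (by positivity)).comp (Real.tendsto_sqrt_atTop.comp tendsto_natCast_atTop_atTop)
  refine h.congr' ?_
  filter_upwards [eventually_ge_atTop 1] with n hn
  have hn' : (0 : ℝ) < n := by exact_mod_cast hn
  simp only [Function.comp, amplitude]
  rw [Real.sqrt_eq_rpow, ← Real.rpow_mul hn'.le, ← mul_assoc ((n : ℝ) ^ σ), ← Real.rpow_add hn']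
  ring_nf

lemma coeff_tendsto_one {a : ℕ → ℝ} {α σ : ℝ}
    (haσ : (fun n : ℕ => a n / (n : ℝ) ^ σ - (1 + α / n)) =O[atTop]
      fun n : ℕ => ((n : ℝ) ^ 2)⁻¹) :
    Tendsto (fun n : ℕ => a n / (n : ℝ) ^ σ) atTop (𝓝 1) := by
  have h1 : Tendsto (fun n : ℕ => ((n : ℝ) ^ 2)⁻¹) atTop (𝓝 0) :=
    ((tendsto_pow_atTop two_ne_zero).comp tendsto_natCast_atTop_atTop).inv_tendsto_atTop
  have h2 : Tendsto (fun n : ℕ => 1 + α / (n : ℝ)) atTop (𝓝 (1 + 0)) :=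
    tendsto_const_nhds.add (tendsto_const_div_atTop_nhds_zero_nat α)
  have h3 := (haσ.trans_tendsto h1).add h2
  simpa using h3

/-- Everything follows from `s² E = n^(1/2-σ)`. The residual, of relative size `n^(σ-2)`,
contributes `n^(-3/2)`, the spectral term `n^(1/2-σ)`; requiring both to be `O(n^(-1-ϱ))` gives `ϱ =
min (σ - 3/2) (1/2)`. The increments of `E` are at least of order `n^(-1/2) E`, the size of `(a s
s)⁻¹`. -/
lemma isDecayingAnsatz_ansatz {a b : ℕ → ℝ} {α β γ σ τ : ℝ}
    (hσ : 3 / 2 < σ) (hγ : |γ| = 1)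
    (haσ : (fun n : ℕ => a n / (n : ℝ) ^ σ - (1 + α / n)) =O[atTop]
      fun n : ℕ => ((n : ℝ) ^ 2)⁻¹)
    (hbσ : (fun n : ℕ => b n / (2 * γ * (n : ℝ) ^ σ) - (1 + β / n)) =O[atTop]
      fun n : ℕ => ((n : ℝ) ^ 2)⁻¹)
    (hτ : τ = 2 * β - 2 * α + σ) (hτ_pos : 0 < τ) :
    IsDecayingAnsatz a b (ansatz σ γ τ) (fun n => Real.exp (4 * √τ * √(n : ℝ)))
      (min (σ - 3 / 2) (1 / 2)) := by
  set c : ℝ := -σ / 2 + 1 / 4 with hc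
  set κ : ℝ := √τ with hκ
  have hκ0 : 0 < κ := Real.sqrt_pos.mpr hτ_pos
  have hc0 : c ≤ 0 := by rw [hc]; linarith
  set ϱ := min (σ - 3 / 2) (1 / 2) with hϱ
  have hϱ1 : ϱ ≤ σ - 3 / 2 := min_le_left _ _
  have hϱ2 : ϱ ≤ 1 / 2 := min_le_right _ _
  have hsign : |(-Real.sign γ)| = 1 := by
    rcases eq_or_eq_neg_of_abs_eq hγ with h | h <;> simp [h, Real.sign_neg]
  have habs (n : ℕ) : |ansatz σ γ τ n| = amplitude c κ n := by
    rw [ansatz_eq σ γ τ hτ_pos.le, abs_mul, abs_pow, hsign, one_pow, one_mul, abs_of_nonneg]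
    unfold amplitude; positivity
  have hsq (n : ℕ) (hn : 1 ≤ n) :
      ansatz σ γ τ n ^ 2 * Real.exp (4 * κ * √(n : ℝ)) = (n : ℝ) ^ (1 / 2 - σ) := by
    rw [← sq_abs, habs, amplitude_sq c κ (by exact_mod_cast hn)]
    congr 1
    rw [hc]; ring
  have hlow : ∀ᶠ n : ℕ in atTop, (n : ℝ) ^ σ / 2 ≤ a n := by
    filter_upwards [(coeff_tendsto_one haσ).eventually (lt_mem_nhds (show (1 / 2 : ℝ) < 1 by
      norm_num)), eventually_ge_atTop 1] with n hn h1
    have : (0 : ℝ) < (n : ℝ) ^ σ := Real.rpow_pos_of_pos (by exact_mod_cast h1) σ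
    rw [lt_div_iff₀ this] at hn
    linarith
  have hup : a =O[atTop] fun n : ℕ => (n : ℝ) ^ σ := by
    refine (((coeff_tendsto_one haσ).isBigO_one ℝ).mul
      (isBigO_refl (fun n : ℕ => (n : ℝ) ^ σ) atTop)).congr' ?_ ?_
    · filter_upwards [eventually_ge_atTop 1] with n h1
      have : (0 : ℝ) < (n : ℝ) ^ σ := Real.rpow_pos_of_pos (by exact_mod_cast h1) σ
      field_simp
    · exact Eventually.of_forall fun n => one_mul _
  have hdiff : (fun n : ℕ => (n : ℝ) ^ (-(1 / 2) : ℝ) * Real.exp (4 * κ * √(n : ℝ))) =O[atTop]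
      fun n : ℕ => Real.exp (4 * κ * √((n + 1 : ℕ) : ℝ)) - Real.exp (4 * κ * √(n : ℝ)) := by
    refine IsBigO.of_bound (3 / (4 * κ)) ?_
    filter_upwards [eventually_ge_atTop 1] with n h1
    have hn' : (1 : ℝ) ≤ n := by exact_mod_cast h1
    rw [Real.norm_of_nonneg (by positivity)]
    refine (rpow_mul_exp_le_sub hκ0 hn').trans ?_
    push_cast
    exact mul_le_mul_of_nonneg_left (Real.le_norm_self _) (by positivity)
  have hmono : Monotone fun n : ℕ => Real.exp (4 * κ * √(n : ℝ)) := by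
    intro m n hmn
    apply Real.exp_le_exp.mpr
    have := Real.sqrt_le_sqrt (show (m : ℝ) ≤ n by exact_mod_cast hmn)
    nlinarith
  refine ⟨lt_min (by linarith) (by norm_num), hmono, fun n => Real.exp_pos _, ?_, ?_, ?_, ?_, ?_,
    ?_, ?_, ?_⟩
  · intro n hn
    rw [← abs_pos, habs]
    exact amplitude_pos _ _ (by exact_mod_cast hn)
  · refine IsBigO.trans ?_ hdiff
    -- The `2` comes from `a n ≥ n^σ / 2`, the denominator from the lower bound for `s (n+1)` in
    -- terms of `s n`.
    refine IsBigO.of_bound (2 / (2 ^ c * Real.exp (-2 * κ))) ?_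
    filter_upwards [eventually_ge_atTop 1, hlow] with n h1 h2
    have hn' : (1 : ℝ) ≤ n := by exact_mod_cast h1
    have hn0 : (0 : ℝ) < n := by linarith
    have hA := amplitude_pos c κ hn0
    have hpow : (0 : ℝ) < (n : ℝ) ^ σ := Real.rpow_pos_of_pos hn0 σ
    rw [norm_inv, norm_mul, norm_mul, Real.norm_eq_abs, Real.norm_eq_abs, Real.norm_eq_abs, habs,
      habs, abs_of_nonneg (by linarith), Real.norm_of_nonneg (by positivity)]
    have h3 := amplitude_succ_ge hc0 hκ0.le hn'
    have h4 : (n : ℝ) ^ (-(1 / 2) : ℝ) * Real.exp (4 * κ * √(n : ℝ)) =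
        ((n : ℝ) ^ σ * amplitude c κ n ^ 2)⁻¹ := by
      have := amplitude_sq c κ hn0
      have h5 : Real.exp (4 * κ * √(n : ℝ)) = (n : ℝ) ^ (2 * c) * (amplitude c κ n ^ 2)⁻¹ := by
        rw [← this]; field_simp
      rw [h5, ← mul_assoc, ← Real.rpow_add hn0, mul_inv, ← Real.rpow_neg hn0.le]
      congr 2
      rw [hc]; ring
    rw [h4]
    have h6 : (0 : ℝ) < 2 ^ c * Real.exp (-2 * κ) := by positivity
    rw [show 2 / (2 ^ c * Real.exp (-2 * κ)) * ((n : ℝ) ^ σ * amplitude c κ n ^ 2)⁻¹ =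
      ((n : ℝ) ^ σ / 2 * amplitude c κ n *
        (2 ^ c * Real.exp (-2 * κ) * amplitude c κ n))⁻¹ by field_simp]
    apply inv_anti₀ (by positivity)
    push_cast
    have : 0 ≤ a n := by linarith
    gcongr
  · have h := residual_isBigO hγ haσ hbσ hτ hτ_pos
    have h1 := ((isBigO_refl (fun n : ℕ => ansatz σ γ τ (n + 1)) atTop).mul h).mul
      (isBigO_refl (fun n : ℕ => Real.exp (4 * κ * √((n + 1 : ℕ) : ℝ))) atTop)
    refine h1.trans (IsBigO.of_bound 1 (Eventually.of_forall fun n => ?_))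
    have hx : (0 : ℝ) < (n : ℝ) + 1 := by positivity
    have e := hsq (n + 1) (by omega)
    rw [show ansatz σ γ τ (n + 1) * (ansatz σ γ τ (n + 1) * ((n : ℝ) + 1) ^ σ *
      (((n : ℝ) + 1) ^ 2)⁻¹) * Real.exp (4 * κ * √((n + 1 : ℕ) : ℝ)) =
      (ansatz σ γ τ (n + 1) ^ 2 * Real.exp (4 * κ * √((n + 1 : ℕ) : ℝ))) * ((n : ℝ) + 1) ^ σ *
      (((n : ℝ) + 1) ^ 2)⁻¹ by ring, e]
    push_cast
    rw [← Real.rpow_add hx, ← Real.rpow_natCast, ← Real.rpow_neg hx.le, ← Real.rpow_add hx,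
      Real.norm_of_nonneg (by positivity), Real.norm_of_nonneg (by positivity), one_mul]
    apply Real.rpow_le_rpow_of_exponent_le (by linarith [(Nat.cast_nonneg n : (0 : ℝ) ≤ n)])
    push_cast
    linarith
  · refine IsBigO.of_bound 1 ?_
    filter_upwards [eventually_ge_atTop 1] with n h1
    rw [hsq n h1, Real.norm_of_nonneg (by positivity), Real.norm_of_nonneg (by positivity), one_mul]
    exact Real.rpow_le_rpow_of_exponent_le (by exact_mod_cast h1) (by linarith)
  · refine IsBigO.trans (IsBigO.of_bound 1 ?_) hdiff
    filter_upwards [eventually_ge_atTop 1] with n h1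
    rw [show ansatz σ γ τ n ^ 2 * Real.exp (4 * κ * √(n : ℝ)) ^ 2 =
      (ansatz σ γ τ n ^ 2 * Real.exp (4 * κ * √(n : ℝ))) * Real.exp (4 * κ * √(n : ℝ)) by ring,
      hsq n h1, Real.norm_of_nonneg (by positivity), Real.norm_of_nonneg (by positivity), one_mul]
    gcongr
    · exact_mod_cast h1
    · linarith
  · refine IsBigO.of_bound (Real.exp (4 * κ)) (Eventually.of_forall fun n => ?_)
    rw [Real.norm_of_nonneg (by positivity), Real.norm_of_nonneg (by positivity), ← Real.exp_add]
    apply Real.exp_le_exp.mpr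
    push_cast
    nlinarith [sqrt_succ_sub_le_one n (Nat.cast_nonneg n)]
  · refine IsBigO.trans_tendsto ?_ (tendsto_rpow_mul_amplitude σ c hκ0)
    refine hup.mul (IsBigO.of_bound 1 (Eventually.of_forall fun n => ?_))
    rw [Real.norm_eq_abs, habs, one_mul]
    exact Real.le_norm_self _
  · refine IsBigO.trans_tendsto ?_ (tendsto_rpow_mul_amplitude σ c hκ0)
    refine hup.mul (IsBigO.of_bound 1 ?_)
    filter_upwards [eventually_ge_atTop 1] with n h1
    rw [Real.norm_eq_abs, habs, one_mul]
    refine le_trans ?_ (Real.le_norm_self _)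
    push_cast
    exact amplitude_anti hc0 hκ0.le (by exact_mod_cast h1)

/-! ### Construction of the Jost solution -/

/-- The Neumann series inverts the pencil, and inversion is analytic on units. For `R ≤ 0` the ball
is empty, so no sign of `R` has to be assumed. -/
lemma exists_inverse_pencil {A : Type*} [NormedRing A] [NormedAlgebra ℂ A] [CompleteSpace A]
    (K₀ K₁ : A) {R : ℝ} (h : ‖K₀‖ + R * ‖K₁‖ < 1 ∨ R ≤ 0) :
    ∃ S : ℂ → A, DifferentiableOn ℂ S (Metric.ball 0 R) ∧
      ∀ z ∈ Metric.ball (0 : ℂ) R, (1 - (z • K₁ - K₀)) * S z = 1 := by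
  rcases h with h | h
  swap
  · exact ⟨0, differentiableOn_const 0, fun z hz => by
      rw [Metric.ball_eq_empty.mpr h] at hz; exact hz.elim⟩
  have hunit (z : ℂ) (hz : z ∈ Metric.ball (0 : ℂ) R) : IsUnit (1 - (z • K₁ - K₀)) := by
    apply isUnit_one_sub_of_norm_lt_one
    have hz' : ‖z‖ < R := by simpa using hz
    calc ‖z • K₁ - K₀‖ ≤ ‖z • K₁‖ + ‖K₀‖ := norm_sub_le _ _
      _ ≤ R * ‖K₁‖ + ‖K₀‖ := by
        rw [norm_smul]
        gcongr
      _ < 1 := by linarith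
  refine ⟨fun z => Ring.inverse (1 - (z • K₁ - K₀)), fun z hz => ?_,
    fun z hz => Ring.mul_inverse_cancel _ (hunit z hz)⟩
  have h2 : DifferentiableAt ℂ (fun z : ℂ => 1 - (z • K₁ - K₀)) z := by fun_prop
  exact (DifferentiableAt.comp z (differentiableAt_inverse (𝕜 := ℂ) (hunit z hz))
    h2).differentiableWithinAt

open BoundedContinuousFunction in
/-- Solution of a discrete Volterra-type equation that depends on a parameter. -/
lemma exists_volterra_solution (g₀ g₁ : ℕ → ℕ →ᵇ ℂ) (R : ℝ)
    (h₀ : Summable fun j => ‖g₀ j‖) (h₁ : Summable fun j => ‖g₁ j‖)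
    (hR : ∑' j, ‖g₀ j‖ + R * ∑' j, ‖g₁ j‖ < 1) :
    ∃ u : ℂ → ℕ →ᵇ ℂ, DifferentiableOn ℂ u (Metric.ball 0 R) ∧
      ∀ z ∈ Metric.ball (0 : ℂ) R, ∀ L : (ℕ →ᵇ ℂ) →L[ℂ] ℂ,
        HasSum (fun j => u z (j + 1) * L (g₀ j - z • g₁ j)) (L 1 - L (u z)) := by
  -- The Volterra operator is the norm-convergent sum of the rank-one operators "evaluate at `j +
  -- 1`, multiply by the column `g j`".
  let δ (j : ℕ) : (ℕ →ᵇ ℂ) →L[ℂ] ℂ := evalCLM ℂ (j + 1)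
  have hnorm (g : ℕ → ℕ →ᵇ ℂ) (j : ℕ) :
      ‖(δ j).smulRight (g j)‖ ≤ ‖g j‖ := by
    refine ContinuousLinearMap.opNorm_le_bound _ (norm_nonneg _) fun v => ?_
    rw [ContinuousLinearMap.smulRight_apply, norm_smul, mul_comm]
    exact mul_le_mul_of_nonneg_left (norm_coe_le_norm v _) (norm_nonneg _)
  have hsum (g : ℕ → ℕ →ᵇ ℂ) (h : Summable fun j => ‖g j‖) :
      Summable fun j => ‖(δ j).smulRight (g j)‖ :=
    Summable.of_nonneg_of_le (fun _ => norm_nonneg _) (hnorm g) h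
  set K₀ : (ℕ →ᵇ ℂ) →L[ℂ] (ℕ →ᵇ ℂ) := ∑' j, (δ j).smulRight (g₀ j) with hK₀
  set K₁ : (ℕ →ᵇ ℂ) →L[ℂ] (ℕ →ᵇ ℂ) := ∑' j, (δ j).smulRight (g₁ j) with hK₁
  have n₀ : ‖K₀‖ ≤ ∑' j, ‖g₀ j‖ :=
    (norm_tsum_le_tsum_norm (hsum g₀ h₀)).trans ((hsum g₀ h₀).tsum_le_tsum (hnorm g₀) h₀)
  have n₁ : ‖K₁‖ ≤ ∑' j, ‖g₁ j‖ :=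
    (norm_tsum_le_tsum_norm (hsum g₁ h₁)).trans ((hsum g₁ h₁).tsum_le_tsum (hnorm g₁) h₁)
  have hR0 : ‖K₀‖ + R * ‖K₁‖ < 1 ∨ R ≤ 0 := by
    rcases le_or_gt R 0 with h | h
    · exact Or.inr h
    · exact Or.inl (lt_of_le_of_lt (add_le_add n₀ (mul_le_mul_of_nonneg_left n₁ h.le)) hR)
  obtain ⟨S, hS, hS'⟩ := exists_inverse_pencil K₀ K₁ hR0
  refine ⟨fun z => S z 1, fun z hz => ?_, fun z hz L => ?_⟩
  · exact (hS z hz).clm_apply (differentiableWithinAt_const _)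
  · set u := S z 1 with hu
    have h1 : u - (z • K₁ u - K₀ u) = 1 := congrArg (fun T : (ℕ →ᵇ ℂ) →L[ℂ] (ℕ →ᵇ ℂ) => T 1)
      (hS' z hz)
    have h2 : L 1 - L u = L (K₀ u) - z * L (K₁ u) := by
      rw [← h1]
      simp only [map_sub, map_smul, smul_eq_mul]
      ring
    have hs (g : ℕ → ℕ →ᵇ ℂ) (h : Summable fun j => ‖g j‖) : HasSum (fun j => u (j + 1) * L (g j))
        (L ((∑' j, (δ j).smulRight (g j) : (ℕ →ᵇ ℂ) →L[ℂ] (ℕ →ᵇ ℂ)) u)) := by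
      have := ((hsum g h).of_norm.hasSum.mapL
        (ContinuousLinearMap.apply ℂ (ℕ →ᵇ ℂ) u)).mapL L
      simpa [δ] using this
    rw [h2]
    refine ((hs g₀ h₀).sub ((hs g₁ h₁).mul_left z)).congr_fun fun j => ?_
    rw [map_sub, map_smul, smul_eq_mul]
    ring

lemma hasSum_sub_succ_of_antitone {h : ℕ → ℝ} (ha : Antitone h) (ht : Tendsto h atTop (𝓝 0)) :
    HasSum (fun j => h j - h (j + 1)) (h 0) := by
  rw [hasSum_iff_tendsto_nat_of_nonneg fun j => sub_nonneg.mpr (ha (Nat.le_succ j))]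
  simp only [Finset.sum_range_sub']
  simpa using tendsto_const_nhds.sub ht

/-- It majorises the bounds `n^(-1-ϱ)` by a telescoping sequence, so that tail sums are at most
`n^(-ϱ)/ϱ`. The inequality is `log y ≤ y - 1` at `y = x/(x+1)` combined with `1 + v ≤ e^v`. -/
lemma rpow_tail_le {ϱ x : ℝ} (hϱ : 0 < ϱ) (hx : 0 < x) :
    (x + 1) ^ (-1 - ϱ) ≤ 1 / ϱ * (x ^ (-ϱ) - (x + 1) ^ (-ϱ)) := by
  have hx1 : 0 < x + 1 := by linarith
  have h1 : Real.log (x / (x + 1)) ≤ x / (x + 1) - 1 := Real.log_le_sub_one_of_pos (by positivity)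
  have h2 : 1 + ϱ / (x + 1) ≤ (x / (x + 1)) ^ (-ϱ) := by
    rw [Real.rpow_def_of_pos (by positivity)]
    have h3 := Real.add_one_le_exp (Real.log (x / (x + 1)) * -ϱ)
    have h4 : x / (x + 1) - 1 = -(1 / (x + 1)) := by field_simp; ring
    rw [h4] at h1
    have h5 : ϱ / (x + 1) = ϱ * (1 / (x + 1)) := by ring
    nlinarith
  have h6 : (x / (x + 1)) ^ (-ϱ) * (x + 1) ^ (-ϱ) = x ^ (-ϱ) := by
    rw [← Real.mul_rpow (by positivity) (by positivity)]; congr 1; field_simp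
  have h7 : (x + 1) ^ (-1 - ϱ) = (x + 1) ^ (-ϱ) / (x + 1) := by
    rw [show -1 - ϱ = -ϱ - 1 by ring, Real.rpow_sub_one hx1.ne']
  rw [← h6, h7, div_mul_eq_mul_div, le_div_iff₀ hϱ, one_mul]
  have h8 : 0 < (x + 1) ^ (-ϱ) := Real.rpow_pos_of_pos hx1 _
  have h9 := mul_le_mul_of_nonneg_right h2 h8.le
  calc (x + 1) ^ (-ϱ) / (x + 1) * ϱ = (1 + ϱ / (x + 1)) * (x + 1) ^ (-ϱ) - (x + 1) ^ (-ϱ) := by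
        field_simp; ring
    _ ≤ _ := by linarith

lemma shiftedCoeff_ne_zero (ha : ∀ n, 0 < a n) (n : ℕ) : (shiftedCoeff a n : ℂ) ≠ 0 := by
  cases n with
  | zero => simp [shiftedCoeff]
  | succ n => simpa [shiftedCoeff] using (ha n).ne'

/-- The recurrence can be solved for its lowest entry by dividing by a constant independent of `z`,
which preserves analyticity. Each induction step overwrites one entry. -/
lemma exists_backward_extension {a b : ℕ → ℝ} (ha : ∀ n, 0 < a n) {U : Set ℂ} (N : ℕ) :
    ∀ v : ℂ → ℕ → ℂ, (∀ n, DifferentiableOn ℂ (fun z => v z n) U) →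
      (∀ z ∈ U, ∀ n, N ≤ n → shiftedCoeff a n * v z n + b n * v z (n + 1) +
        a n * v z (n + 2) = z * v z (n + 1)) →
      ∃ w : ℂ → ℕ → ℂ, (∀ n, DifferentiableOn ℂ (fun z => w z n) U) ∧
        (∀ z ∈ U, SolvesJacobi a b z (w z)) ∧ ∀ z n, N ≤ n → w z n = v z n := by
  induction N with
  | zero => exact fun v hv hs => ⟨v, hv, fun z hz n => hs z hz n n.zero_le, fun _ _ _ => rfl⟩
  | succ N ih =>
    intro v hv hs
    obtain ⟨w, hw, hws, hwv⟩ := ih (fun z => Function.update (v z) N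
      ((z * v z (N + 1) - b N * v z (N + 1) - a N * v z (N + 2)) / shiftedCoeff a N))
      (fun n => by
        by_cases hn : n = N
        · subst hn
          simp only [Function.update_self]
          exact (((differentiableOn_id.mul (hv _)).sub ((hv _).const_mul _)).sub
            ((hv _).const_mul _)).div_const _
        · simpa only [Function.update_of_ne hn] using hv n)
      (fun z hz n hn => by
        rw [Function.update_of_ne (by omega : n + 1 ≠ N), Function.update_of_ne
          (by omega : n + 2 ≠ N)]
        by_cases h : n = N
        · subst h
          have h0 := shiftedCoeff_ne_zero ha n
          rw [Function.update_self]
          field_simp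
          ring
        · rw [Function.update_of_ne h]
          exact hs z hz n (by omega))
    refine ⟨w, hw, hws, fun z n hn => ?_⟩
    rw [hwv z n (by omega), Function.update_of_ne (by omega : n ≠ N)]

open BoundedContinuousFunction in
lemma exists_boundedContinuousFunction (φ : ℕ → ℕ → ℂ) (B : ℕ → ℝ)
    (h : ∀ j i, ‖φ j i‖ ≤ B j) :
    ∃ g : ℕ → ℕ →ᵇ ℂ, (∀ j i, g j i = φ j i) ∧ ∀ j, ‖g j‖ ≤ B j := by
  refine ⟨fun j => BoundedContinuousFunction.ofNormedAddCommGroupDiscrete (φ j) (B j) (h j),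
    fun j i => rfl, fun j => ?_⟩
  exact (BoundedContinuousFunction.norm_le ((norm_nonneg _).trans (h j 0))).mpr (h j)

lemma abs_sum_Ico_le {q E : ℕ → ℝ} {C : ℝ} {N : ℕ} (hC : 0 ≤ C) (hE : ∀ n, 0 < E n)
    (hq : ∀ k, N ≤ k → |q k| ≤ C * (E (k + 1) - E k)) {m n : ℕ} (hm : N ≤ m) :
    |∑ k ∈ Finset.Ico m n, q k| ≤ C * E n := by
  rcases le_total n m with h | h
  · rw [Finset.Ico_eq_empty_of_le h, Finset.sum_empty, abs_zero]
    exact mul_nonneg hC (hE n).le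
  · calc |∑ k ∈ Finset.Ico m n, q k| ≤ ∑ k ∈ Finset.Ico m n, |q k| :=
        Finset.abs_sum_le_sum_abs _ _
      _ ≤ ∑ k ∈ Finset.Ico m n, C * (E (k + 1) - E k) :=
        Finset.sum_le_sum fun k hk => hq k (hm.trans (Finset.mem_Ico.mp hk).1)
      _ = C * (E n - E m) := by rw [← Finset.mul_sum, Finset.sum_Ico_sub _ h]
      _ ≤ C * E n := by
        apply mul_le_mul_of_nonneg_left _ hC
        linarith [hE m]

/-- The differences of the column `i ↦ ∑ k ∈ [i, j], q k` of the Volterra kernel. -/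
lemma sum_Ico_second_difference (q : ℕ → ℂ) (N i j : ℕ) (h₀ : q (N + i) ≠ 0)
    (h₁ : q (N + i + 1) ≠ 0) :
    (q (N + i))⁻¹ * ((∑ k ∈ Finset.Ico (N + (i + 1)) (N + j + 1), q k) -
        ∑ k ∈ Finset.Ico (N + i) (N + j + 1), q k) -
      (q (N + i + 1))⁻¹ * ((∑ k ∈ Finset.Ico (N + (i + 2)) (N + j + 1), q k) -
        ∑ k ∈ Finset.Ico (N + (i + 1)) (N + j + 1), q k) = if j = i then -1 else 0 := by
  rcases lt_trichotomy j i with h | h | h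
  · rw [if_neg (by omega), Finset.Ico_eq_empty_of_le (by omega : N + j + 1 ≤ N + i),
      Finset.Ico_eq_empty_of_le (by omega : N + j + 1 ≤ N + (i + 1)),
      Finset.Ico_eq_empty_of_le (by omega : N + j + 1 ≤ N + (i + 2))]
    simp
  · subst h
    rw [if_pos rfl, Finset.Ico_eq_empty_of_le (by omega : N + j + 1 ≤ N + (j + 1)),
      Finset.Ico_eq_empty_of_le (by omega : N + j + 1 ≤ N + (j + 2)), Nat.Ico_succ_singleton]
    simp [h₀]
  · have e₁ : ∑ k ∈ Finset.Ico (N + (i + 1)) (N + j + 1), q k =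
        q (N + i + 1) + ∑ k ∈ Finset.Ico (N + (i + 2)) (N + j + 1), q k :=
      Finset.sum_eq_sum_Ico_succ_bot (by omega) _
    have e₀ : ∑ k ∈ Finset.Ico (N + i) (N + j + 1), q k =
        q (N + i) + ∑ k ∈ Finset.Ico (N + (i + 1)) (N + j + 1), q k :=
      Finset.sum_eq_sum_Ico_succ_bot (by omega) _
    rw [if_neg (by omega), e₀, e₁]
    field_simp
    ring

/-- Solve the Volterra equation for `u = f / s` on indices beyond an `N'` depending on `R`, where
the kernel is a contraction for all `|z| < R`, then extend backwards. -/
lemma exists_jost_on_ball {a b s E : ℕ → ℝ} {ϱ : ℝ} (ha : ∀ n, 0 < a n)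
    (H : IsDecayingAnsatz a b s E ϱ) (R : ℝ) :
    ∃ f : ℂ → ℕ → ℂ, (∀ k, DifferentiableOn ℂ (fun z => f z k) (Metric.ball 0 R)) ∧
      ∀ z ∈ Metric.ball (0 : ℂ) R, SolvesJacobi a b z (f z) ∧
        (fun n => f z (n + 1) - (s n : ℂ)) =O[atTop] fun n : ℕ => s n * (n : ℝ) ^ (-ϱ) := by
  classical
  have hϱ := H.rate_pos
  set q : ℕ → ℝ := fun k => (a k * s k * s (k + 1))⁻¹ with hq
  set r : ℕ → ℝ := fun n => s (n + 1) * (a n * s n + b (n + 1) * s (n + 1) +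
    a (n + 1) * s (n + 2)) with hr
  have hsq : (fun n => s (n + 1) ^ 2 * E (n + 1)) =O[atTop]
      fun n : ℕ => ((n : ℝ) + 1) ^ (-1 - ϱ) :=
    (H.sq_bound.comp_tendsto (tendsto_add_atTop_nat 1)).congr_right fun n => by
      simp [Function.comp]
  obtain ⟨C₁, hC₁, b₁⟩ := H.inv_bound.exists_pos
  obtain ⟨C₂, hC₂, b₂⟩ := H.residual_bound.exists_pos
  obtain ⟨C₃, hC₃, b₃⟩ := hsq.exists_pos
  -- `M N'^(-ϱ)` will bound the norm of the Volterra operator; `N'` is taken so large that this is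
  -- below one.
  set M : ℝ := C₁ * (C₂ + |R| * C₃) / ϱ with hM
  have hMt : Tendsto (fun n : ℕ => M * (n : ℝ) ^ (-ϱ)) atTop (𝓝 0) := by
    simpa using ((tendsto_rpow_neg_atTop hϱ).comp tendsto_natCast_atTop_atTop).const_mul M
  obtain ⟨N, hN⟩ := eventually_atTop.mp ((b₁.bound.and (b₂.bound.and b₃.bound)).and
    (hMt.eventually (gt_mem_nhds zero_lt_one)))
  -- The shift guarantees indices at least `1`, where `s` is known not to vanish.
  set N' := N + 1 with hN'
  have hb₁ (k : ℕ) (hk : N' ≤ k) : |q k| ≤ C₁ * (E (k + 1) - E k) := by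
    have := (hN k (by omega)).1.1
    rwa [Real.norm_of_nonneg (sub_nonneg.mpr (H.mono (Nat.le_succ k)))] at this
  have hpow (k : ℕ) : (0 : ℝ) ≤ ((k : ℝ) + 1) ^ (-1 - ϱ) := by positivity
  have hb₂ (k : ℕ) (hk : N' ≤ k) : |r k| * E (k + 1) ≤ C₂ * ((k : ℝ) + 1) ^ (-1 - ϱ) := by
    have := (hN k (by omega)).1.2.1
    rwa [norm_mul, Real.norm_of_nonneg (hpow k), Real.norm_of_nonneg (H.pos _).le] at this
  have hb₃ (k : ℕ) (hk : N' ≤ k) : s (k + 1) ^ 2 * E (k + 1) ≤ C₃ * ((k : ℝ) + 1) ^ (-1 - ϱ) := by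
    have := (hN k (by omega)).1.2.2
    rwa [Real.norm_of_nonneg (hpow k), Real.norm_of_nonneg
      (mul_nonneg (sq_nonneg _) (H.pos _).le)] at this
  set h : ℕ → ℝ := fun j => ((N' + j : ℕ) : ℝ) ^ (-ϱ) with hh
  have hanti : Antitone h := by
    refine antitone_nat_of_succ_le fun j => ?_
    apply Real.rpow_le_rpow_of_nonpos
    · positivity
    · push_cast; linarith
    · linarith
  have hlim : Tendsto h atTop (𝓝 0) :=
    ((tendsto_rpow_neg_atTop hϱ).comp tendsto_natCast_atTop_atTop).comp
      (tendsto_atTop_mono (fun n => Nat.le_add_left n N') tendsto_id)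
  have htail (j : ℕ) : (((N' + j : ℕ) : ℝ) + 1) ^ (-1 - ϱ) ≤ 1 / ϱ * (h j - h (j + 1)) := by
    have := rpow_tail_le hϱ (show (0 : ℝ) < ((N' + j : ℕ) : ℝ) by positivity)
    simpa [hh, add_assoc] using this
  set Q : ℕ → ℕ → ℝ := fun i j => ∑ k ∈ Finset.Ico (N' + i) (N' + j + 1), q k with hQ
  have hQb (i j : ℕ) : |Q i j| ≤ C₁ * E (N' + j + 1) :=
    abs_sum_Ico_le hC₁.le H.pos hb₁ (by omega)
  have hB₀ (j i : ℕ) : |r (N' + j) * Q i j| ≤ C₁ * C₂ / ϱ * (h j - h (j + 1)) := by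
    rw [abs_mul]
    calc |r (N' + j)| * |Q i j| ≤ |r (N' + j)| * (C₁ * E (N' + j + 1)) := by gcongr; exact hQb i j
      _ = C₁ * (|r (N' + j)| * E (N' + j + 1)) := by ring
      _ ≤ C₁ * (C₂ * (((N' + j : ℕ) : ℝ) + 1) ^ (-1 - ϱ)) :=
        mul_le_mul_of_nonneg_left (hb₂ _ (Nat.le_add_right _ _)) hC₁.le
      _ ≤ C₁ * (C₂ * (1 / ϱ * (h j - h (j + 1)))) := by gcongr; exact htail j
      _ = _ := by ring
  have hB₁ (j i : ℕ) : |s (N' + j + 1) ^ 2 * Q i j| ≤ C₁ * C₃ / ϱ * (h j - h (j + 1)) := by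
    rw [abs_mul, abs_of_nonneg (sq_nonneg _)]
    calc s (N' + j + 1) ^ 2 * |Q i j| ≤ s (N' + j + 1) ^ 2 * (C₁ * E (N' + j + 1)) := by
          gcongr; exact hQb i j
      _ = C₁ * (s (N' + j + 1) ^ 2 * E (N' + j + 1)) := by ring
      _ ≤ C₁ * (C₃ * (((N' + j : ℕ) : ℝ) + 1) ^ (-1 - ϱ)) :=
        mul_le_mul_of_nonneg_left (hb₃ _ (Nat.le_add_right _ _)) hC₁.le
      _ ≤ C₁ * (C₃ * (1 / ϱ * (h j - h (j + 1)))) := by gcongr; exact htail j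
      _ = _ := by ring
  obtain ⟨g₀, hg₀, hn₀⟩ := exists_boundedContinuousFunction
    (fun j i => ((r (N' + j) * Q i j : ℝ) : ℂ)) _
    (fun j i => by rw [Complex.norm_real]; exact hB₀ j i)
  obtain ⟨g₁, hg₁, hn₁⟩ := exists_boundedContinuousFunction
    (fun j i => ((s (N' + j + 1) ^ 2 * Q i j : ℝ) : ℂ)) _
    (fun j i => by rw [Complex.norm_real]; exact hB₁ j i)
  have hs₀ := (hasSum_sub_succ_of_antitone hanti hlim).mul_left (C₁ * C₂ / ϱ)
  have hs₁ := (hasSum_sub_succ_of_antitone hanti hlim).mul_left (C₁ * C₃ / ϱ)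
  have hS₀ : Summable fun j => ‖g₀ j‖ :=
    Summable.of_nonneg_of_le (fun _ => norm_nonneg _) hn₀ hs₀.summable
  have hS₁ : Summable fun j => ‖g₁ j‖ :=
    Summable.of_nonneg_of_le (fun _ => norm_nonneg _) hn₁ hs₁.summable
  have hsmall : ∑' j, ‖g₀ j‖ + R * ∑' j, ‖g₁ j‖ < 1 := by
    have e₀ : ∑' j, ‖g₀ j‖ ≤ C₁ * C₂ / ϱ * h 0 := hasSum_le hn₀ hS₀.hasSum hs₀
    have e₁ : ∑' j, ‖g₁ j‖ ≤ C₁ * C₃ / ϱ * h 0 := hasSum_le hn₁ hS₁.hasSum hs₁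
    have e₂ := (hN N' (by omega)).2
    have e₃ : R * ∑' j, ‖g₁ j‖ ≤ |R| * (C₁ * C₃ / ϱ * h 0) :=
      (mul_le_mul_of_nonneg_right (le_abs_self R) (tsum_nonneg fun _ => norm_nonneg _)).trans
        (mul_le_mul_of_nonneg_left e₁ (abs_nonneg R))
    have e₄ : M * (N' : ℝ) ^ (-ϱ) = C₁ * C₂ / ϱ * h 0 + |R| * (C₁ * C₃ / ϱ * h 0) := by
      simp only [hM, hh, add_zero]; ring
    linarith
  obtain ⟨u, hu, huL⟩ := exists_volterra_solution g₀ g₁ R hS₀ hS₁ hsmall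
  have hq0 (k : ℕ) (hk : N' ≤ k) : (q k : ℂ) ≠ 0 := by
    rw [Complex.ofReal_ne_zero]
    exact inv_ne_zero (mul_ne_zero (mul_ne_zero (ha k).ne' (H.ne_zero _ (by omega)))
      (H.ne_zero _ (by omega)))
  have hrec (z : ℂ) (hz : z ∈ Metric.ball (0 : ℂ) R) (i : ℕ) :
      ((q (N' + i) : ℂ))⁻¹ * (u z (i + 1) - u z i) -
        ((q (N' + i + 1) : ℂ))⁻¹ * (u z (i + 2) - u z (i + 1)) =
      u z (i + 1) * (r (N' + i) - z * s (N' + i + 1) ^ 2) := by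
    -- The functional `L` is the weighted second difference at `i`. It kills constants and sends
    -- every column of the kernel to zero except column `i`, so the Volterra equation collapses to
    -- the difference equation.
    let ev (k : ℕ) := BoundedContinuousFunction.evalCLM ℂ (α := ℕ) (β := ℂ) k
    let L : (BoundedContinuousFunction ℕ ℂ) →L[ℂ] ℂ :=
      ((q (N' + i) : ℂ))⁻¹ • (ev (i + 1) - ev i) -
        ((q (N' + i + 1) : ℂ))⁻¹ • (ev (i + 2) - ev (i + 1))
    have hL (v : BoundedContinuousFunction ℕ ℂ) : L v =
      ((q (N' + i) : ℂ))⁻¹ * (v (i + 1) - v i) -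
        ((q (N' + i + 1) : ℂ))⁻¹ * (v (i + 2) - v (i + 1)) := rfl
    have h1 := huL z hz L
    have h2 : L 1 = 0 := by simp [hL]
    have h3 (j : ℕ) : L (g₀ j - z • g₁ j) =
        if j = i then -(r (N' + i) - z * s (N' + i + 1) ^ 2) else 0 := by
      have e := sum_Ico_second_difference (fun k => (q k : ℂ)) N' i j (hq0 _ (by omega))
        (hq0 _ (by omega))
      have e' : L (g₀ j - z • g₁ j) = (r (N' + j) - z * s (N' + j + 1) ^ 2) *
          (if j = i then -1 else 0) := by
        rw [← e, hL]
        simp only [BoundedContinuousFunction.coe_sub, BoundedContinuousFunction.coe_smul,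
          Pi.sub_apply, hg₀, hg₁, hQ, smul_eq_mul]
        push_cast
        ring
      rw [e']
      split_ifs with hji
      · rw [hji]; ring
      · ring
    have h4 : HasSum (fun j => u z (j + 1) * L (g₀ j - z • g₁ j))
        (u z (i + 1) * -(r (N' + i) - z * s (N' + i + 1) ^ 2)) := by
      refine (hasSum_ite_eq i (u z (i + 1) * -(r (N' + i) - z * s (N' + i + 1) ^ 2))).congr_fun
        fun j => ?_
      rw [h3]
      split_ifs with hji
      · rw [hji]
      · rw [mul_zero]
    have h5 := h1.unique h4
    rw [h2] at h5
    rw [← hL]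
    linear_combination -h5
  obtain ⟨f, hf, hfs, hfv⟩ := exists_backward_extension (b := b) ha (U := Metric.ball 0 R) (N' + 1)
    (fun z n => (s (n - 1) : ℂ) * u z (n - 1 - N'))
    (fun n z hz => by
      have := (BoundedContinuousFunction.evalCLM ℂ (α := ℕ) (β := ℂ)
        (n - 1 - N')).differentiableAt.comp_differentiableWithinAt z (hu z hz)
      exact this.const_mul _)
    (fun z hz n hn => by
      obtain ⟨i, rfl⟩ : ∃ i, n = N' + i + 1 := ⟨n - N' - 1, by omega⟩
      have e := hrec z hz i
      simp only [shiftedCoeff, Nat.add_sub_cancel, show N' + i + 1 + 1 - 1 = N' + i + 1 by omega,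
        show N' + i + 1 + 2 - 1 = N' + i + 2 by omega, show N' + i - N' = i by omega,
        show N' + i + 1 - N' = i + 1 by omega, show N' + i + 2 - N' = i + 2 by omega]
      have hs1 : (s (N' + i + 1) : ℂ) ≠ 0 := by
        rw [Complex.ofReal_ne_zero]; exact H.ne_zero _ (by omega)
      apply mul_left_cancel₀ hs1
      simp only [hq, hr] at e
      push_cast at e
      simp only [inv_inv] at e
      linear_combination -e)
  refine ⟨f, hf, fun z hz => ⟨hfs z hz, ?_⟩⟩
  refine IsBigO.of_bound (‖u z‖ * (C₁ * C₂ / ϱ + ‖z‖ * (C₁ * C₃ / ϱ))) ?_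
  filter_upwards [eventually_ge_atTop N'] with n hn
  obtain ⟨i, rfl⟩ : ∃ i, n = N' + i := ⟨n - N', by omega⟩
  rw [hfv z _ (by omega)]
  simp only [Nat.add_sub_cancel, show N' + i - N' = i by omega]
  have h1 := huL z hz (BoundedContinuousFunction.evalCLM ℂ i)
  -- Columns `j < i` vanish at `i`. The sequence `h (max i j)` has no increments there, so the sum
  -- over all `j` telescopes to the tail value `h i`, which yields the rate `n^(-ϱ)`.
  have h2 := (hasSum_sub_succ_of_antitone (h := fun j => h (max i j))
    (fun j k hjk => hanti (max_le_max le_rfl hjk))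
    (hlim.comp (tendsto_atTop_mono (fun j => le_max_right i j) tendsto_id))).mul_left
    (‖u z‖ * (C₁ * C₂ / ϱ + ‖z‖ * (C₁ * C₃ / ϱ)))
  have h3 := h1.norm_le_of_bounded h2 (fun j => by
    rw [norm_mul, mul_assoc]
    refine mul_le_mul ((u z).norm_coe_le_norm _) ?_ (norm_nonneg _) (norm_nonneg _)
    have e : (BoundedContinuousFunction.evalCLM ℂ i) (g₀ j - z • g₁ j) = g₀ j i - z * g₁ j i := rfl
    rw [e]
    rcases lt_or_ge j i with hji | hji
    · have hz0 : Q i j = 0 := by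
        simp only [hQ]
        rw [Finset.Ico_eq_empty_of_le (by omega), Finset.sum_empty]
      rw [hg₀, hg₁, hz0, max_eq_left hji.le, max_eq_left (by omega : j + 1 ≤ i)]
      simp
    · rw [max_eq_right hji, max_eq_right (by omega : i ≤ j + 1), add_mul]
      refine (norm_sub_le _ _).trans (add_le_add ?_ ?_)
      · rw [hg₀, Complex.norm_real]; exact hB₀ j i
      · rw [norm_mul, mul_assoc, hg₁, Complex.norm_real]
        exact mul_le_mul_of_nonneg_left (hB₁ j i) (norm_nonneg _))
  have h4 : ‖u z i - 1‖ ≤ ‖u z‖ * (C₁ * C₂ / ϱ + ‖z‖ * (C₁ * C₃ / ϱ)) *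
      ((N' + i : ℕ) : ℝ) ^ (-ϱ) := by
    rw [norm_sub_rev]
    simpa [hh] using h3
  rw [show (s (N' + i) : ℂ) * u z i - s (N' + i) = s (N' + i) * (u z i - 1) by ring, norm_mul,
    norm_mul, Complex.norm_real, Real.norm_of_nonneg (by positivity : (0 : ℝ) ≤
    ((N' + i : ℕ) : ℝ) ^ (-ϱ))]
  calc ‖s (N' + i)‖ * ‖u z i - 1‖ ≤ ‖s (N' + i)‖ * (‖u z‖ * (C₁ * C₂ / ϱ + ‖z‖ * (C₁ * C₃ / ϱ)) *
      ((N' + i : ℕ) : ℝ) ^ (-ϱ)) := mul_le_mul_of_nonneg_left h4 (norm_nonneg _)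
    _ = _ := by ring

/-! ### Solutions of the Jacobi equation -/

section Solutions

variable {a b : ℕ → ℝ} {z : ℂ} {u v : ℕ → ℂ}

lemma SolvesJacobi.sub (hu : SolvesJacobi a b z u) (hv : SolvesJacobi a b z v) :
    SolvesJacobi a b z (u - v) := fun n => by
  simp only [Pi.sub_apply]
  linear_combination hu n - hv n

lemma SolvesJacobi.const_smul (hu : SolvesJacobi a b z u) (c : ℂ) :
    SolvesJacobi a b z (c • u) := fun n => by
  simp only [Pi.smul_apply, smul_eq_mul]
  linear_combination c * hu n

lemma solvesJacobi_orthPoly (ha : ∀ n, 0 < a n) (z : ℂ) :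
    SolvesJacobi a b z (orthPoly a b z) := fun n => by
  have : (a n : ℂ) ≠ 0 := Complex.ofReal_ne_zero.mpr (ha n).ne'
  rw [orthPoly]
  field_simp
  ring

lemma SolvesJacobi.wronskian_eq (hu : SolvesJacobi a b z u) (hv : SolvesJacobi a b z v) (k : ℕ) :
    wronskian a u v k = wronskian a u v 0 := by
  induction k with
  | zero => rfl
  | succ k ih =>
    rw [← ih, wronskian, wronskian, show shiftedCoeff a (k + 1) = a k from rfl]
    linear_combination (-v (k + 1)) * hu k + u (k + 1) * hv k

lemma SolvesJacobi.eq_zero (ha : ∀ n, 0 < a n) (hu : SolvesJacobi a b z u) (h₀ : u 0 = 0)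
    (h₁ : u 1 = 0) : u = 0 := by
  have : ∀ n, u n = 0 ∧ u (n + 1) = 0 := by
    intro n
    induction n with
    | zero => exact ⟨h₀, h₁⟩
    | succ n ih =>
      refine ⟨ih.2, ?_⟩
      have := hu n
      rw [ih.1, ih.2] at this
      simpa [(ha n).ne'] using this
  funext n
  exact (this n).1

lemma SolvesJacobi.eq_smul_of_wronskian_eq_zero (ha : ∀ n, 0 < a n) (hu : SolvesJacobi a b z u)
    (hv : SolvesJacobi a b z v) (hv0 : v ≠ 0) (hw : wronskian a u v 0 = 0) :
    ∃ c : ℂ, u = c • v := by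
  have hw' : u 0 * v 1 - u 1 * v 0 = 0 := by
    simpa [wronskian, shiftedCoeff] using hw
  have key (c : ℂ) (e₀ : u 0 = c * v 0) (e₁ : u 1 = c * v 1) : ∃ c : ℂ, u = c • v :=
    ⟨c, sub_eq_zero.mp ((hu.sub (hv.const_smul c)).eq_zero ha (by simp [e₀]) (by simp [e₁]))⟩
  by_cases h : v 0 = 0
  · have h1 : v 1 ≠ 0 := fun h1 => hv0 (hv.eq_zero ha h h1)
    refine key (u 1 / v 1) ?_ (by field_simp)
    have : u 0 * v 1 = 0 := by simpa [h] using hw'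
    simp [h, (mul_eq_zero.mp this).resolve_right h1]
  · refine key (u 0 / v 0) (by field_simp) ?_
    field_simp
    linear_combination -hw'

lemma orthPoly_ne_zero (a b : ℕ → ℝ) (z : ℂ) : orthPoly a b z ≠ 0 := fun h => by
  have : orthPoly a b z 1 = 0 := by rw [h]; rfl
  simp [orthPoly] at this

lemma SolvesJacobi.eq_smul_orthPoly (ha : ∀ n, 0 < a n) (hu : SolvesJacobi a b z u)
    (h₀ : u 0 = 0) : ∃ c : ℂ, u = c • orthPoly a b z :=
  hu.eq_smul_of_wronskian_eq_zero ha (solvesJacobi_orthPoly ha z) (orthPoly_ne_zero a b z)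
    (by simp [wronskian, h₀, orthPoly])

lemma wronskian_orthPoly (ha : ∀ n, 0 < a n) {f : ℂ → ℕ → ℂ} (hf : SolvesJacobi a b z (f z))
    (k : ℕ) : wronskian a (orthPoly a b z) (f z) k = jostFunction f z := by
  rw [(solvesJacobi_orthPoly ha z).wronskian_eq hf k]
  simp [wronskian, orthPoly, jostFunction, shiftedCoeff]
  ring

end Solutions

/-! ### Consequences of the decay -/

/-- Summing the increments leaves a constant of integration, which is absorbed because `E` is
increasing and positive. -/
lemma isBigO_of_sub_isBigO {x : ℕ → ℂ} {E : ℕ → ℝ} (hmono : Monotone E) (hpos : ∀ n, 0 < E n)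
    (h : (fun n => x (n + 1) - x n) =O[atTop] fun n => E (n + 1) - E n) : x =O[atTop] E := by
  obtain ⟨C, hC, hb⟩ := h.exists_pos
  obtain ⟨N, hN⟩ := eventually_atTop.mp hb.bound
  refine IsBigO.of_bound (‖x N‖ / E N + C) ?_
  filter_upwards [eventually_ge_atTop N] with n hn
  have h1 : ‖x n‖ ≤ ‖x N‖ + C * (E n - E N) := by
    induction n, hn using Nat.le_induction with
    | base => simp
    | succ n hn ih =>
      have := hN n hn
      rw [Real.norm_of_nonneg (sub_nonneg.mpr (hmono (Nat.le_succ n)))] at this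
      have h2 : ‖x (n + 1)‖ ≤ ‖x n‖ + ‖x (n + 1) - x n‖ := by
        simpa using norm_add_le (x n) (x (n + 1) - x n)
      nlinarith
  rw [Real.norm_of_nonneg (hpos n).le, add_mul]
  have h2 : ‖x N‖ ≤ ‖x N‖ / E N * E n := by
    rw [div_mul_eq_mul_div, le_div_iff₀ (hpos N)]
    exact mul_le_mul_of_nonneg_left (hmono hn) (norm_nonneg _)
  nlinarith [hpos N]

namespace IsDecayingAnsatz

variable {a b s E : ℕ → ℝ} {ϱ : ℝ}

lemma sq_isBigO (H : IsDecayingAnsatz a b s E ϱ) :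
    (fun n => s n ^ 2) =O[atTop] fun n : ℕ => (n : ℝ) ^ (-1 - ϱ) := by
  refine IsBigO.trans (IsBigO.of_bound (E 0)⁻¹ (Eventually.of_forall fun n => ?_)) H.sq_bound
  rw [norm_mul, Real.norm_of_nonneg (H.pos n).le]
  have h1 : (1 : ℝ) ≤ (E 0)⁻¹ * E n := by
    rw [inv_mul_eq_div, one_le_div (H.pos 0)]; exact H.mono n.zero_le
  nlinarith [norm_nonneg (s n ^ 2)]

lemma tendsto_rpow (H : IsDecayingAnsatz a b s E ϱ) :
    Tendsto (fun n : ℕ => (n : ℝ) ^ (-ϱ)) atTop (𝓝 0) :=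
  (tendsto_rpow_neg_atTop H.rate_pos).comp tendsto_natCast_atTop_atTop

lemma tendsto_zero (H : IsDecayingAnsatz a b s E ϱ) : Tendsto s atTop (𝓝 0) := by
  have h1 : Tendsto (fun n : ℕ => (n : ℝ) ^ (-1 - ϱ)) atTop (𝓝 0) := by
    have := (tendsto_rpow_neg_atTop (show 0 < 1 + ϱ by linarith [H.rate_pos])).comp
      (tendsto_natCast_atTop_atTop (R := ℝ))
    simp only [show -1 - ϱ = -(1 + ϱ) by ring]
    exact this
  have h2 := H.sq_isBigO.trans_tendsto h1
  have h3 : Tendsto (fun n => √(s n ^ 2)) atTop (𝓝 0) := by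
    simpa using h2.sqrt
  simp only [Real.sqrt_sq_eq_abs] at h3
  exact (tendsto_zero_iff_abs_tendsto_zero s).mpr h3

/-- Two solutions that are `O(s)` have vanishing Wronskian. -/
lemma wronskian_eq_zero (H : IsDecayingAnsatz a b s E ϱ) {z : ℂ} {u v : ℕ → ℂ}
    (hu : SolvesJacobi a b z u) (hv : SolvesJacobi a b z v)
    (hus : Tendsto (fun n => u (n + 1)) atTop (𝓝 0))
    (hvs : (fun n => v (n + 1)) =O[atTop] s) : wronskian a u v 0 = 0 := by
  have h1 : Tendsto (fun n => (a n : ℂ) * v (n + 1)) atTop (𝓝 0) :=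
    (IsBigO.mul (IsBigO.of_bound 1 (Eventually.of_forall fun n => by simp)) hvs).trans_tendsto
      H.mul_tendsto
  have h2 : Tendsto (fun n => (a n : ℂ) * v (n + 2)) atTop (𝓝 0) := by
    have := (hvs.comp_tendsto (tendsto_add_atTop_nat 1))
    exact (IsBigO.mul (IsBigO.of_bound 1 (Eventually.of_forall fun n => by simp))
      this).trans_tendsto H.mul_succ_tendsto
  -- Since `a n v` already tends to zero, it suffices that `u` does; this later covers every `u` in
  -- `ℓ²`.
  have h3 := (hus.mul h2).sub ((hus.comp (tendsto_add_atTop_nat 1)).mul h1)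
  simp only [mul_zero, sub_zero] at h3
  refine tendsto_nhds_unique (tendsto_const_nhds (x := wronskian a u v 0)) (h3.congr fun n => ?_)
  rw [← hu.wronskian_eq hv (n + 1)]
  simp only [wronskian, shiftedCoeff, Function.comp]
  ring

/-- The increment of `u/f` is a constant Wronskian over `a f f`, hence dominated by that of `E`. So
`u = O(s E)`, the partial sums of `|u|²` are `O(E)`, and the terms are `O(s² E)`, which is summable.
-/
lemma summable_sq_mul_sum_sq (H : IsDecayingAnsatz a b s E ϱ) (ha : ∀ n, 0 < a n) {z : ℂ}
    {u f : ℕ → ℂ} (hu : SolvesJacobi a b z u) (hf : SolvesJacobi a b z f)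
    (hfs : (fun n => f (n + 1)) =O[atTop] s) (hsf : s =O[atTop] fun n => f (n + 1)) :
    Summable fun m => ‖f (m + 1)‖ ^ 2 * ∑ n ∈ Finset.range (m + 1), ‖u (n + 1)‖ ^ 2 := by
  have hne : ∀ᶠ n in atTop, f (n + 1) ≠ 0 := by
    filter_upwards [hsf.eq_zero_imp, eventually_ge_atTop 1] with n hn h1 h2
    exact H.ne_zero n h1 (hn h2)
  have h1 : (fun n => u (n + 2) / f (n + 2) - u (n + 1) / f (n + 1)) =O[atTop]
      fun n => E (n + 1) - E n := by
    refine IsBigO.trans ?_ H.inv_bound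
    have e1 : (fun n => ((a n : ℂ) * f (n + 1) * f (n + 2))⁻¹) =O[atTop]
        fun n => (a n * s n * s (n + 1))⁻¹ := by
      refine IsBigO.inv_rev ?_ ?_
      · have e2 : (fun n => s (n + 1)) =O[atTop] fun n => f (n + 2) :=
          hsf.comp_tendsto (tendsto_add_atTop_nat 1)
        have e3 : a =O[atTop] fun n => (a n : ℂ) :=
          IsBigO.of_bound 1 (Eventually.of_forall fun n => by simp)
        exact (e3.mul hsf).mul e2
      · filter_upwards [eventually_ge_atTop 1] with n hn h
        exact absurd h (mul_ne_zero (mul_ne_zero (ha n).ne' (H.ne_zero n hn))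
          (H.ne_zero _ (by omega)))
    refine (e1.const_mul_left (-wronskian a u f 0)).congr' ?_ EventuallyEq.rfl
    filter_upwards [hne, (tendsto_add_atTop_nat 1).eventually hne] with n hn hn'
    have ha' : (a n : ℂ) ≠ 0 := Complex.ofReal_ne_zero.mpr (ha n).ne'
    have hn'' : f (n + 2) ≠ 0 := hn'
    have hw := hu.wronskian_eq hf (n + 1)
    rw [← hw]
    simp only [wronskian, shiftedCoeff]
    rw [show n + 1 + 1 = n + 2 from rfl]
    field_simp
    ring
  have h2 : (fun n => u (n + 1) / f (n + 1)) =O[atTop] E :=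
    isBigO_of_sub_isBigO H.mono H.pos h1
  have h3 : (fun n => u (n + 1)) =O[atTop] fun n => s n * E n := by
    refine (hfs.mul h2).congr' ?_ EventuallyEq.rfl
    filter_upwards [hne] with n hn
    field_simp
  have h4 : (fun m => ((∑ n ∈ Finset.range m, ‖u (n + 1)‖ ^ 2 : ℝ) : ℂ)) =O[atTop] E := by
    refine isBigO_of_sub_isBigO H.mono H.pos (IsBigO.trans ?_ H.growth_bound)
    refine (IsBigO.of_bound 1 (Eventually.of_forall fun n => ?_)).trans ((h3.pow 2).congr_right
      fun n => mul_pow _ _ _)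
    rw [Finset.sum_range_succ, ← Complex.ofReal_sub, add_sub_cancel_left, Complex.norm_real]
    simp
  have h5 : (fun m => (∑ n ∈ Finset.range (m + 1), ‖u (n + 1)‖ ^ 2 : ℝ)) =O[atTop] E := by
    refine IsBigO.trans ?_ H.succ_bound
    refine (IsBigO.of_bound 1 (Eventually.of_forall fun n => ?_)).trans
      (h4.comp_tendsto (tendsto_add_atTop_nat 1))
    simp only [Function.comp, Complex.norm_real, one_mul, le_refl]
  have h6 := ((hfs.norm_left.pow 2).mul h5).trans H.sq_bound
  exact summable_of_isBigO_nat (Real.summable_nat_rpow.mpr (by linarith [H.rate_pos])) h6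

end IsDecayingAnsatz

/-! ### Uniqueness of the Jost solution and its analyticity on the whole plane -/

namespace IsDecayingAnsatz

variable {a b s E : ℕ → ℝ} {ϱ : ℝ}

lemma isLittleO_of_isBigO (H : IsDecayingAnsatz a b s E ϱ) {x : ℕ → ℂ}
    (hx : x =O[atTop] fun n : ℕ => s n * (n : ℝ) ^ (-ϱ)) : x =o[atTop] s := by
  refine hx.trans_isLittleO ?_
  have := (isBigO_refl s atTop).mul_isLittleO
    ((isLittleO_one_iff ℝ).mpr H.tendsto_rpow)
  simpa using this

lemma isBigO_of_jost (H : IsDecayingAnsatz a b s E ϱ) {f : ℕ → ℂ}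
    (hf : (fun n => f (n + 1) - (s n : ℂ)) =O[atTop] fun n : ℕ => s n * (n : ℝ) ^ (-ϱ)) :
    (fun n => f (n + 1)) =O[atTop] s ∧ s =O[atTop] fun n => f (n + 1) := by
  have h1 := H.isLittleO_of_isBigO hf
  have hs : (fun n => (s n : ℂ)) =O[atTop] s :=
    IsBigO.of_bound 1 (Eventually.of_forall fun n => by simp)
  have hs' : s =O[atTop] fun n => (s n : ℂ) :=
    IsBigO.of_bound 1 (Eventually.of_forall fun n => by simp)
  refine ⟨(h1.isBigO.add hs).congr_left fun n => by ring, ?_⟩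
  exact hs'.trans ((h1.trans_isBigO hs').right_isBigO_add'.congr_right fun n => by simp)

/-- Both are `O(s)`, so `f - g` and `f` have zero Wronskian and `f - g = c f`. But `f - g = o(s)`
while `f` is of exact size `s`, whence `c = 0`. -/
lemma jost_unique (H : IsDecayingAnsatz a b s E ϱ) (ha : ∀ n, 0 < a n) {z : ℂ} {f g : ℕ → ℂ}
    (hfs : SolvesJacobi a b z f) (hgs : SolvesJacobi a b z g)
    (hf : (fun n => f (n + 1) - (s n : ℂ)) =O[atTop] fun n : ℕ => s n * (n : ℝ) ^ (-ϱ))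
    (hg : (fun n => g (n + 1) - (s n : ℂ)) =O[atTop] fun n : ℕ => s n * (n : ℝ) ^ (-ϱ)) :
    f = g := by
  obtain ⟨hfO, hOf⟩ := H.isBigO_of_jost hf
  have hd : (fun n => (f - g) (n + 1)) =o[atTop] s :=
    H.isLittleO_of_isBigO ((hf.sub hg).congr_left fun n => by simp)
  have hw := H.wronskian_eq_zero (hfs.sub hgs) hfs
    (hd.isBigO.trans_tendsto H.tendsto_zero) hfO
  have hs0 : ∃ᶠ n in atTop, s n ≠ 0 :=
    ((eventually_ge_atTop 1).mono fun n hn => H.ne_zero n hn).frequently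
  have hf0 : f ≠ 0 := by
    rintro rfl
    refine hs0 (hOf.eq_zero_imp.mono fun n hn => ?_)
    simpa using hn rfl
  obtain ⟨c, hc⟩ := (hfs.sub hgs).eq_smul_of_wronskian_eq_zero ha hfs hf0 hw
  have h1 : (fun n => c * f (n + 1)) =o[atTop] fun n => f (n + 1) := by
    refine (hd.trans_isBigO hOf).congr_left fun n => ?_
    rw [hc]; rfl
  have hc0 : c = 0 := by
    by_contra h
    have h2 : (fun n => f (n + 1)) =o[atTop] fun n => f (n + 1) :=
      (isLittleO_const_mul_left_iff h).mp h1
    exact isLittleO_irrefl ((hs0.and_eventually hOf.eq_zero_imp).mono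
      fun n hn h => hn.1 (hn.2 h)) h2
  rw [hc0, zero_smul] at hc
  exact sub_eq_zero.mp hc

/-- At each `z` take the solution built on the ball of radius `‖z‖ + 1`. By uniqueness it agrees
near `z` with one fixed analytic family. -/
lemma exists_jost (H : IsDecayingAnsatz a b s E ϱ) (ha : ∀ n, 0 < a n) :
    ∃ f : ℂ → ℕ → ℂ, (∀ k, Differentiable ℂ fun z => f z k) ∧ ∀ z, SolvesJacobi a b z (f z) ∧
      (fun n => f z (n + 1) - (s n : ℂ)) =O[atTop] fun n : ℕ => s n * (n : ℝ) ^ (-ϱ) := by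
  choose F hFd hF using exists_jost_on_ball (b := b) ha H
  have hmem (z : ℂ) : z ∈ Metric.ball (0 : ℂ) (‖z‖ + 1) := by simp
  refine ⟨fun z => F (‖z‖ + 1) z, fun k z => ?_, fun z => hF _ z (hmem z)⟩
  have hd := (hFd (‖z‖ + 1) k).differentiableAt (Metric.isOpen_ball.mem_nhds (hmem z))
  refine hd.congr_of_eventuallyEq ?_
  filter_upwards [Metric.isOpen_ball.mem_nhds (hmem z)] with w hw
  obtain ⟨h1, h2⟩ := hF _ w (hmem w)
  obtain ⟨h3, h4⟩ := hF _ w hw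
  rw [H.jost_unique ha h1 h3 h2 h4]

end IsDecayingAnsatz

/-! ### Resolvents of unbounded operators -/

section Resolvent

variable {H : Type*} [NormedAddCommGroup H] [InnerProductSpace ℂ H] {T : H →ₗ.[ℂ] H} {z w : ℂ}
  {R S : H →L[ℂ] H}

lemma IsResolventAt.eq (hR : IsResolventAt T z R) (hS : IsResolventAt T z S) : R = S := by
  ext y
  obtain ⟨h, e⟩ := hR.1 y
  have := hS.2 ⟨R y, h⟩
  rw [e] at this
  exact this.symm

lemma IsResolventAt.resolventOf_eq (hR : IsResolventAt T z R) : resolventOf T z = R := by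
  have h : ∃ R : H →L[ℂ] H, IsResolventAt T z R := ⟨R, hR⟩
  rw [resolventOf, dif_pos h]
  exact h.choose_spec.eq hR

lemma isResolventAt_resolventOf (hz : z ∈ resolventSetOf T) :
    IsResolventAt T z (resolventOf T z) := by
  obtain ⟨R, hR⟩ := hz
  rwa [hR.resolventOf_eq]

lemma IsResolventAt.sub_eq (hR : IsResolventAt T z R) (hS : IsResolventAt T w S) :
    S - R = (w - z) • (R * S) := by
  ext y
  obtain ⟨h, e⟩ := hS.1 y
  have h1 := hR.2 ⟨S y, h⟩
  have h2 : T ⟨S y, h⟩ - z • S y = y + (w - z) • S y := by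
    rw [sub_eq_iff_eq_add.mp e, sub_smul]
    abel
  rw [h2, map_add, map_smul] at h1
  change S y - R y = (w - z) • R (S y)
  exact sub_eq_iff_eq_add'.mpr h1.symm

lemma IsResolventAt.injective (hR : IsResolventAt T z R) : Function.Injective R := by
  rw [injective_iff_map_eq_zero]
  intro y hy
  obtain ⟨h, e⟩ := hR.1 y
  have : (⟨R y, h⟩ : T.domain) = 0 := Subtype.ext hy
  rw [this, hy] at e
  simpa using e.symm

lemma IsResolventAt.commute (hR : IsResolventAt T z R) (hS : IsResolventAt T w S) :
    Commute R S := by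
  by_cases h : w = z
  · subst h; rw [hR.eq hS]
  · have h1 := hR.sub_eq hS
    have h2 := hS.sub_eq hR
    have h3 : (w - z) • (R * S) = (w - z) • (S * R) := by
      rw [← h1, ← neg_sub R S, h2, ← neg_smul, neg_sub]
    exact smul_right_injective _ (sub_ne_zero.mpr h) h3

/-- A non-zero point of the spectrum of the resolvent at `z` has the form `(λ - z)⁻¹` with `λ` in
the spectrum of the operator. -/
lemma IsResolventAt.add_inv_mem_spectrumOf (hR : IsResolventAt T z R) {μ : ℂ} (hμ : μ ≠ 0)
    (h : μ ∈ spectrum ℂ R) : z + μ⁻¹ ∈ spectrumOf T := by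
  intro hw
  obtain ⟨S, hS⟩ := hw
  apply h
  have h1 := hR.sub_eq hS
  rw [add_sub_cancel_left] at h1
  have hc : R * S = S * R := hR.commute hS
  have e : S = R + μ⁻¹ • (R * S) := by rw [← h1]; abel
  -- If `z + μ⁻¹` were regular with resolvent `S`, the resolvent identity `S = R + μ⁻¹ R S` would
  -- make this an explicit inverse of `μ - R`.
  have key : (μ • 1 - R) * (μ⁻¹ • (1 + μ⁻¹ • S)) = 1 := by
    have : (μ • 1 - R) * (μ⁻¹ • (1 + μ⁻¹ • S)) =
        (μ * μ⁻¹) • 1 + μ⁻¹ • ((μ * μ⁻¹) • S - (R + μ⁻¹ • (R * S))) := by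
      simp only [mul_add, sub_mul, smul_mul_assoc, mul_smul_comm, one_mul, mul_one, smul_add,
        smul_sub, smul_smul]
      module
    rw [this, ← e, mul_inv_cancel₀ hμ]
    simp
  have hcomm : Commute (μ • 1 - R) (μ⁻¹ • (1 + μ⁻¹ • S)) := by
    have h0 : Commute R S := hc
    refine Commute.smul_right (Commute.add_right (Commute.one_right _) (Commute.smul_right ?_ _)) _
    exact Commute.sub_left (Commute.smul_left (Commute.one_left _) _) h0
  rw [spectrum.mem_resolventSet_iff, Algebra.algebraMap_eq_smul_one]
  exact ⟨⟨_, _, key, hcomm.eq ▸ key⟩, rfl⟩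

/-- The resolvent identity gives `R(w) = R(z) (1 - (w - z) R(z))⁻¹` near `z`. -/
lemma analyticAt_resolventOf [CompleteSpace H] [Nontrivial H]
    (hz : ∀ᶠ w in 𝓝 z, w ∈ resolventSetOf T) : AnalyticAt ℂ (resolventOf T) z := by
  have hR := isResolventAt_resolventOf hz.self_of_nhds
  set R := resolventOf T z with hRdef
  have h0 : (1 - (z - z) • R) = 1 := by simp
  have h1 : AnalyticAt ℂ (fun w => R * Ring.inverse (1 - (w - z) • R)) z := by
    have e : AnalyticAt ℂ (fun w : ℂ => 1 - (w - z) • R) z := by fun_prop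
    have e2 : AnalyticAt ℂ Ring.inverse (1 - (z - z) • R) := by
      rw [h0]
      exact analyticAt_inverse (𝕜 := ℂ) (1 : (H →L[ℂ] H)ˣ)
    exact analyticAt_const.mul (AnalyticAt.fun_comp (f := fun w : ℂ => 1 - (w - z) • R) e2 e)
  refine h1.congr ?_
  have hunit : ∀ᶠ w in 𝓝 z, IsUnit (1 - (w - z) • R) := by
    have hc : ContinuousAt (fun w : ℂ => 1 - (w - z) • R) z := by fun_prop
    refine hc.eventually (p := IsUnit) (Units.isOpen.mem_nhds ?_)
    simp only [h0]
    exact isUnit_one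
  filter_upwards [hz, hunit] with w hw hu
  have hS := isResolventAt_resolventOf hw
  have h2 : resolventOf T w * (1 - (w - z) • R) = R := by
    have := hR.sub_eq hS
    rw [mul_sub, mul_one, mul_smul_comm, ← (hR.commute hS).eq, ← this]
    abel
  calc R * Ring.inverse (1 - (w - z) • R)
      = resolventOf T w * (1 - (w - z) • R) * Ring.inverse (1 - (w - z) • R) := by rw [h2]
    _ = resolventOf T w := by rw [mul_assoc, Ring.mul_inverse_cancel _ hu, mul_one]

end Resolvent

/-! ### Resolvents of symmetric operators with real spectrum -/

lemma conj_mem_resolventSetOf {H : Type*} [NormedAddCommGroup H] [InnerProductSpace ℂ H]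
    {T : H →ₗ.[ℂ] H} {z : ℂ} (hreal : ∀ w ∈ spectrumOf T, w.im = 0)
    (hz : z ∈ resolventSetOf T) : starRingEnd ℂ z ∈ resolventSetOf T := by
  by_contra h
  have h1 := hreal _ h
  rw [Complex.conj_im, neg_eq_zero] at h1
  rw [Complex.conj_eq_iff_im.mpr h1] at h
  exact h hz

section SymmetricResolvent

variable {H : Type*} [NormedAddCommGroup H] [InnerProductSpace ℂ H] [CompleteSpace H]
  {T : H →ₗ.[ℂ] H} {z : ℂ} {R S : H →L[ℂ] H}

open scoped ComplexConjugate

lemma IsResolventAt.eq_adjoint (hT : T.IsFormalAdjoint T) (hR : IsResolventAt T z R)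
    (hS : IsResolventAt T (conj z) S) : S = ContinuousLinearMap.adjoint R := by
  rw [ContinuousLinearMap.eq_adjoint_iff]
  intro x y
  obtain ⟨hx, ex⟩ := hS.1 x
  obtain ⟨hy, ey⟩ := hR.1 y
  have h1 := hT ⟨S x, hx⟩ ⟨R y, hy⟩
  conv_lhs => rw [← ey]
  conv_rhs => rw [← ex]
  simp only [inner_sub_left, inner_sub_right, inner_smul_left, inner_smul_right,
    Complex.conj_conj]
  rw [h1]

/-- The adjoint of the resolvent at `z` is the resolvent at the conjugate point, and resolvents
commute. -/
lemma IsResolventAt.isStarNormal (hT : T.IsFormalAdjoint T)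
    (hreal : ∀ w ∈ spectrumOf T, w.im = 0) (hR : IsResolventAt T z R) : IsStarNormal R := by
  have hS := isResolventAt_resolventOf (conj_mem_resolventSetOf hreal ⟨R, hR⟩)
  have e := hR.eq_adjoint hT hS
  rw [← ContinuousLinearMap.star_eq_adjoint] at e
  exact ⟨by rw [← e]; exact hS.commute hR⟩

/-- The norm of a normal operator is its spectral radius, and the nonzero points of its spectrum are
`(w - z)⁻¹` with `w` in the spectrum of `T`. -/
lemma IsResolventAt.norm_le (hT : T.IsFormalAdjoint T) (hreal : ∀ w ∈ spectrumOf T, w.im = 0)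
    (hR : IsResolventAt T z R) {d : ℝ} (hd : 0 < d) (h : ∀ w ∈ spectrumOf T, d ≤ ‖w - z‖) :
    ‖R‖ ≤ d⁻¹ := by
  have := hR.isStarNormal hT hreal
  have h1 : spectralRadius ℂ R ≤ ENNReal.ofReal d⁻¹ := by
    refine iSup₂_le fun μ hμ => ?_
    rcases eq_or_ne μ 0 with rfl | h0
    · simp
    · have h2 := h _ (hR.add_inv_mem_spectrumOf h0 hμ)
      rw [add_sub_cancel_left, norm_inv] at h2
      rw [show ((‖μ‖₊ : NNReal) : ENNReal) = ENNReal.ofReal ‖μ‖ from (ofReal_norm μ).symm]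
      apply ENNReal.ofReal_le_ofReal
      exact (le_inv_comm₀ hd (norm_pos_iff.mpr h0)).mp h2
  rw [IsStarNormal.spectralRadius_eq_nnnorm] at h1
  have h3 := ENNReal.toReal_mono ENNReal.ofReal_ne_top h1
  rwa [ENNReal.toReal_ofReal (by positivity), ENNReal.coe_toReal, coe_nnnorm] at h3

/-- Near an isolated point the distance to the spectrum is `‖w - z‖`, so `(w - z) R(w)` is bounded
and its singularity is removable. -/
lemma meromorphicAt_resolventOf [Nontrivial H] (hT : T.IsFormalAdjoint T)
    (hreal : ∀ w ∈ spectrumOf T, w.im = 0) (hz : z ∈ spectrumOf T)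
    (hiso : ∃ U ∈ 𝓝 z, U ∩ spectrumOf T = {z}) : MeromorphicAt (resolventOf T) z := by
  obtain ⟨U, hU, hUz⟩ := hiso
  obtain ⟨ε, hε, hball⟩ := Metric.mem_nhds_iff.mp hU
  have hdist (w : ℂ) (hw : w ∈ spectrumOf T) (hne : w ≠ z) : ε ≤ ‖w - z‖ := by
    by_contra h
    have : w ∈ U ∩ spectrumOf T := ⟨hball (by rw [mem_ball_iff_norm]; linarith), hw⟩
    rw [hUz] at this
    exact hne this
  have hres (w : ℂ) (hw : w ∈ Metric.ball z ε) (hne : w ≠ z) : w ∈ resolventSetOf T := by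
    by_contra h
    rw [mem_ball_iff_norm] at hw
    linarith [hdist w h hne]
  have hbound (w : ℂ) (hw : w ∈ Metric.ball z (ε / 2)) (hne : w ≠ z) :
      ‖(w - z) • resolventOf T w‖ ≤ 1 := by
    rw [mem_ball_iff_norm] at hw
    have hpos : 0 < ‖w - z‖ := norm_pos_iff.mpr (sub_ne_zero.mpr hne)
    have h1 := (isResolventAt_resolventOf (hres w (by rw [mem_ball_iff_norm]; linarith)
      hne)).norm_le hT hreal hpos (fun v hv => by
        rcases eq_or_ne v z with rfl | hvz
        · rw [norm_sub_rev]
        · have h2 := hdist v hv hvz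
          have h3 := norm_sub_le_norm_sub_add_norm_sub v w z
          linarith)
    rw [norm_smul]
    calc ‖w - z‖ * ‖resolventOf T w‖ ≤ ‖w - z‖ * ‖w - z‖⁻¹ := by gcongr
      _ = 1 := mul_inv_cancel₀ hpos.ne'
  set g : ℂ → H →L[ℂ] H := fun w => (w - z) • resolventOf T w with hg
  have hd : DifferentiableOn ℂ g (Metric.ball z (ε / 2) \ {z}) := by
    intro w hw
    have hw' : w ∈ Metric.ball z ε \ {z} := ⟨Metric.ball_subset_ball (by linarith) hw.1, hw.2⟩
    have hopen : ∀ᶠ v in 𝓝 w, v ∈ resolventSetOf T := by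
      filter_upwards [(Metric.isOpen_ball.sdiff isClosed_singleton).mem_nhds hw'] with v hv
      exact hres v hv.1 hv.2
    have := (analyticAt_resolventOf hopen).differentiableAt
    exact (((differentiableAt_id.sub_const z).smul this)).differentiableWithinAt
  have hnhds : Metric.ball z (ε / 2) ∈ 𝓝 z := Metric.ball_mem_nhds z (by linarith)
  have hb : BddAbove (norm ∘ g '' (Metric.ball z (ε / 2) \ {z})) :=
    ⟨1, by rintro _ ⟨w, hw, rfl⟩; exact hbound w hw.1 hw.2⟩
  have h1 := Complex.differentiableOn_update_limUnder_of_bddAbove hnhds hd hb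
  have h2 := h1.analyticAt hnhds
  -- One factor `w - z` removes the singularity; the second makes the value at `w = z` zero, so that
  -- it agrees with the analytic extension there as well.
  refine ⟨2, ?_⟩
  have h3 : AnalyticAt ℂ (fun w : ℂ => w - z) z := by fun_prop
  refine (h3.smul h2).congr (Eventually.of_forall fun w => ?_)
  rcases eq_or_ne w z with rfl | hne
  · simp
  · simp only [Pi.smul_apply', Function.update_of_ne hne, hg, smul_smul, sq]

/-- For an eigenvector `y` at `z` one has `(z - w) R(w) y = y`. If the resolvent had a limit at `z`,
the left side would tend to zero. -/
lemma meromorphicOrderAt_resolventOf_neg (hz : MeromorphicAt (resolventOf T) z)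
    (hiso : ∀ᶠ w in 𝓝[≠] z, w ∈ resolventSetOf T) (hev : IsEigenvalueOf T z) :
    meromorphicOrderAt (resolventOf T) z < 0 := by
  by_contra! hcon
  obtain ⟨c, hc⟩ := tendsto_nhds_of_meromorphicOrderAt_nonneg hz hcon
  obtain ⟨φ, hφ, hφ0⟩ := (Submodule.ne_bot_iff _).mp hev
  have hφ' : (φ, z • φ) ∈ T.graph := hφ
  obtain ⟨⟨y, hy⟩, hy1, hy2⟩ := (LinearPMap.mem_graph_iff T).mp hφ'
  simp only at hy1 hy2
  subst hy1
  have h1 : Tendsto (fun w : ℂ => (z - w) • resolventOf T w y) (𝓝[≠] z) (𝓝 ((z - z) • c y)) := by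
    refine Tendsto.smul ?_ ?_
    · exact (tendsto_const_nhds.sub tendsto_id).mono_left nhdsWithin_le_nhds
    · exact ((ContinuousLinearMap.apply ℂ H y).continuous.tendsto c).comp hc
  have h2 : Tendsto (fun w : ℂ => (z - w) • resolventOf T w y) (𝓝[≠] z) (𝓝 y) := by
    refine tendsto_const_nhds.congr' ?_
    filter_upwards [hiso] with w hw
    have := (isResolventAt_resolventOf hw).2 ⟨y, hy⟩
    rw [hy2, ← sub_smul, map_smul] at this
    exact this.symm
  have := tendsto_nhds_unique h2 h1
  rw [sub_self, zero_smul] at this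
  exact hφ0 this

/-! ### Infinitude of the spectrum -/

lemma finiteDimensional_ker_aeval_prod {V : Type*} [AddCommGroup V] [Module ℂ V]
    (A : Module.End ℂ V) (s : Finset ℂ)
    (h : ∀ μ ∈ s, FiniteDimensional ℂ (LinearMap.ker (A - algebraMap ℂ _ μ))) :
    FiniteDimensional ℂ (LinearMap.ker (Polynomial.aeval A
      (∏ μ ∈ s, (Polynomial.X - Polynomial.C μ)))) := by
  classical
  induction s using Finset.induction_on with
  | empty =>
    have e : LinearMap.ker (Polynomial.aeval A
        (∏ μ ∈ (∅ : Finset ℂ), (Polynomial.X - Polynomial.C μ))) = ⊥ := by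
      rw [Finset.prod_empty, map_one]
      exact LinearMap.ker_id
    rw [e]
    infer_instance
  | insert μ s hμ ih =>
    rw [Finset.prod_insert hμ, ← Polynomial.sup_ker_aeval_eq_ker_aeval_mul_of_coprime]
    · have h1 := ih fun ν hν => h ν (Finset.mem_insert_of_mem hν)
      have h2 := h μ (Finset.mem_insert_self μ s)
      have h3 : Polynomial.aeval A (Polynomial.X - Polynomial.C μ) = A - algebraMap ℂ _ μ := by
        simp
      rw [h3]
      infer_instance
    · refine IsCoprime.prod_right fun ν hν => ?_
      exact Polynomial.isCoprime_X_sub_C_of_isUnit_sub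
        (sub_ne_zero.mpr (ne_of_mem_of_not_mem hν hμ).symm).isUnit

/-- A finite spectrum would make the resolvent at `i` a normal operator annihilated by a polynomial
with simple roots. The whole space would be the sum of the kernels of the linear factors, all
finite-dimensional. -/
lemma infinite_spectrumOf (hT : T.IsFormalAdjoint T) (hreal : ∀ w ∈ spectrumOf T, w.im = 0)
    (hfin : ∀ w ∈ spectrumOf T, FiniteDimensional ℂ (eigenspaceOf T w))
    (hinf : ¬ FiniteDimensional ℂ H) : (spectrumOf T).Infinite := by
  classical
  intro hs
  have hz : Complex.I ∈ resolventSetOf T := by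
    by_contra h
    have := hreal _ h
    simp at this
  have hR := isResolventAt_resolventOf hz
  set R := resolventOf T Complex.I
  have := hR.isStarNormal hT hreal
  set F : Finset ℂ := insert 0 (hs.toFinset.image fun w => (w - Complex.I)⁻¹) with hF
  set p : Polynomial ℂ := ∏ μ ∈ F, (Polynomial.X - Polynomial.C μ) with hp
  -- The point `0` is put into `F` because the resolvent of an unbounded operator is not invertible
  -- in general; its factor has zero kernel since `R` is injective.
  have hsub : spectrum ℂ R ⊆ F := by
    intro μ hμ
    rcases eq_or_ne μ 0 with rfl | h0
    · simp [hF]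
    · have h1 := hR.add_inv_mem_spectrumOf h0 hμ
      simp only [hF, Finset.coe_insert, Finset.coe_image, Set.Finite.coe_toFinset]
      exact Or.inr ⟨_, h1, by simp⟩
  have hp0 : Polynomial.aeval R p = 0 := by
    rw [← cfc_polynomial p R]
    have : (spectrum ℂ R).EqOn p.eval fun _ => 0 := fun μ hμ => by
      simp only [hp, Polynomial.eval_prod]
      exact Finset.prod_eq_zero (hsub hμ) (by simp)
    rw [cfc_congr this, cfc_const_zero]
  set A : Module.End ℂ H := R.toLinearMap with hA
  have hA0 : Polynomial.aeval A p = 0 := by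
    let φ : (H →L[ℂ] H) →ₐ[ℂ] Module.End ℂ H :=
      { ContinuousLinearMap.toLinearMapRingHom with commutes' := fun r => rfl }
    have := Polynomial.aeval_algHom_apply φ R p
    rw [hp0, map_zero] at this
    exact this
  have hker := finiteDimensional_ker_aeval_prod A F fun μ hμ => by
    rw [hF, Finset.mem_insert] at hμ
    rcases hμ with rfl | hμ
    · have e : LinearMap.ker (A - algebraMap ℂ _ 0) = ⊥ := by
        rw [map_zero, sub_zero]
        exact LinearMap.ker_eq_bot.mpr hR.injective
      rw [e]
      infer_instance
    · obtain ⟨w, hw, rfl⟩ := Finset.mem_image.mp hμ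
      rw [Set.Finite.mem_toFinset] at hw
      have hfw := hfin w hw
      have hne : w - Complex.I ≠ 0 := by
        intro h
        rw [sub_eq_zero.mp h] at hw
        exact hw hz
      refine Submodule.finiteDimensional_of_le (S₂ := eigenspaceOf T w) fun x hx => ?_
      have hx' : R x = (w - Complex.I)⁻¹ • x := by
        have := LinearMap.mem_ker.mp hx
        exact sub_eq_zero.mp this
      obtain ⟨h1, h2⟩ := hR.1 x
      have hmem : (R x, x + Complex.I • R x) ∈ T.graph :=
        (LinearPMap.mem_graph_iff T).mpr ⟨⟨R x, h1⟩, rfl, sub_eq_iff_eq_add.mp h2⟩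
      have h3 := T.graph.smul_mem (w - Complex.I) hmem
      have h4 : (w - Complex.I) • (R x, x + Complex.I • R x) = (x, w • x) := by
        rw [hx', Prod.smul_mk, smul_add, smul_comm (w - Complex.I) Complex.I, smul_smul,
          mul_inv_cancel₀ hne, one_smul, sub_smul, sub_add_cancel]
      rw [h4] at h3
      exact h3
  rw [hA0, LinearMap.ker_zero] at hker
  exact hinf (Module.finite_def.mpr ((Submodule.fg_top _).mp
    (Module.finite_def.mp hker)))

end SymmetricResolvent

/-! ### Hilbert-Schmidt operators in `ℓ²` -/

lemma memlp_two_iff {u : ℕ → ℂ} : Memℓp u 2 ↔ Summable fun n => ‖u n‖ ^ 2 := by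
  rw [memℓp_gen_iff (by norm_num)]
  norm_num

lemma norm_sq_eq_tsum (u : EllTwo) : ‖u‖ ^ 2 = ∑' n, ‖u n‖ ^ 2 := by
  have := lp.norm_rpow_eq_tsum (p := 2) (by norm_num) u
  norm_num at this
  exact this

lemma basisVec_apply (m n : ℕ) : (basisVec m : ℕ → ℂ) n = if n = m then 1 else 0 := by
  rw [basisVec, lp.single_apply]
  by_cases h : n = m
  · subst h; simp
  · simp [h]

lemma inner_basisVec_left (n : ℕ) (u : EllTwo) : inner ℂ (basisVec n) u = u n := by
  rw [basisVec, lp.inner_single_left]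
  simp

lemma tendsto_sum_single (u : EllTwo) :
    Tendsto (fun N => ∑ n ∈ Finset.range N, lp.single 2 n (u n)) atTop (𝓝 u) :=
  (lp.hasSum_single (by norm_num) u).tendsto_sum_nat

lemma single_eq_smul_basisVec (n : ℕ) (c : ℂ) :
    (lp.single 2 n c : EllTwo) = c • basisVec n := by
  rw [basisVec, ← lp.single_smul, smul_eq_mul, mul_one]

/-- Each component is the inner product with a conjugated row, and Cauchy-Schwarz bounds the square
of the norm by the sum of the squared row norms. -/
lemma exists_hilbertSchmidt (G : ℕ → ℕ → ℂ) (hG : Summable fun p : ℕ × ℕ => ‖G p.1 p.2‖ ^ 2) :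
    ∃ T : EllTwo →L[ℂ] EllTwo, ∀ n m, (T (basisVec m) : ℕ → ℂ) n = G n m := by
  let row (n : ℕ) : EllTwo := ⟨fun m => star (G n m), memlp_two_iff.mpr (by
    simpa using hG.prod_factor n)⟩
  have hrow (n : ℕ) : ‖row n‖ ^ 2 = ∑' m, ‖G n m‖ ^ 2 := by
    rw [norm_sq_eq_tsum]
    simp [row]
  have hsum : Summable fun n => ‖row n‖ ^ 2 := by
    simp only [hrow]
    exact hG.prod
  have hle (y : EllTwo) (n : ℕ) : ‖inner ℂ (row n) y‖ ^ 2 ≤ ‖row n‖ ^ 2 * ‖y‖ ^ 2 := by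
    rw [← mul_pow]
    exact pow_le_pow_left₀ (norm_nonneg _) (norm_inner_le_norm _ _) 2
  have hmem (y : EllTwo) : Summable fun n => ‖inner ℂ (row n) y‖ ^ 2 :=
    Summable.of_nonneg_of_le (fun n => by positivity) (hle y) (hsum.mul_right _)
  let T : EllTwo →ₗ[ℂ] EllTwo :=
    { toFun := fun y => ⟨fun n => inner ℂ (row n) y, memlp_two_iff.mpr (hmem y)⟩
      map_add' := fun x y => by
        apply lp.ext
        funext n
        exact inner_add_right _ _ _
      map_smul' := fun c y => by
        apply lp.ext
        funext n
        exact inner_smul_right _ _ _ }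
  refine ⟨T.mkContinuous (√(∑' n, ‖row n‖ ^ 2)) fun y => ?_, fun n m => ?_⟩
  · have h1 : ‖T y‖ ^ 2 ≤ (∑' n, ‖row n‖ ^ 2) * ‖y‖ ^ 2 := by
      rw [norm_sq_eq_tsum, ← tsum_mul_right]
      exact (hmem y).tsum_le_tsum (hle y) (hsum.mul_right _)
    rw [← Real.sqrt_sq (norm_nonneg y), ← Real.sqrt_mul (tsum_nonneg fun n => by positivity)]
    exact Real.le_sqrt_of_sq_le h1
  · change inner ℂ (row n) (basisVec m) = G n m
    rw [← inner_conj_symm, inner_basisVec_left]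
    simp [row]

/-- The kernel is symmetric, so it is dominated by its part on or below the diagonal plus the
transpose of that part. -/
lemma summable_min_max {F P : ℕ → ℂ}
    (h : Summable fun m => ‖F m‖ ^ 2 * ∑ n ∈ Finset.range (m + 1), ‖P n‖ ^ 2) (c : ℂ) :
    Summable fun p : ℕ × ℕ => ‖c * P (min p.1 p.2) * F (max p.1 p.2)‖ ^ 2 := by
  let g : ℕ × ℕ → ℝ := fun p => if p.2 ≤ p.1 then ‖F p.1‖ ^ 2 * ‖P p.2‖ ^ 2 else 0
  have hgle (m n : ℕ) (hn : n ≤ m) : g (m, n) = ‖F m‖ ^ 2 * ‖P n‖ ^ 2 := if_pos hn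
  have hglt (m n : ℕ) (hn : ¬ n ≤ m) : g (m, n) = 0 := if_neg hn
  have hg0 (p : ℕ × ℕ) : 0 ≤ g p := by
    by_cases hp : p.2 ≤ p.1
    · rw [hgle p.1 p.2 hp]; positivity
    · rw [hglt p.1 p.2 hp]
  have hrow (m : ℕ) : HasSum (fun n => g (m, n))
      (‖F m‖ ^ 2 * ∑ n ∈ Finset.range (m + 1), ‖P n‖ ^ 2) := by
    have h1 : ∑ n ∈ Finset.range (m + 1), g (m, n) =
        ‖F m‖ ^ 2 * ∑ n ∈ Finset.range (m + 1), ‖P n‖ ^ 2 := by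
      rw [Finset.mul_sum]
      exact Finset.sum_congr rfl fun n hn =>
        hgle m n (Nat.lt_succ_iff.mp (Finset.mem_range.mp hn))
    rw [← h1]
    refine hasSum_sum_of_ne_finset_zero fun n hn => hglt m n fun h => hn ?_
    exact Finset.mem_range.mpr (Nat.lt_succ_iff.mpr h)
  have hgs : Summable g := by
    rw [summable_prod_of_nonneg hg0]
    refine ⟨fun m => (hrow m).summable, ?_⟩
    simpa only [(hrow _).tsum_eq] using h
  have hgs' : Summable fun p : ℕ × ℕ => g p.swap := hgs.prod_symm
  clear_value g
  refine Summable.of_nonneg_of_le (fun p => sq_nonneg _) ?_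
    ((hgs.add hgs').mul_left (‖c‖ ^ 2))
  rintro ⟨m, n⟩
  rw [norm_mul, norm_mul, mul_pow, mul_pow, mul_assoc]
  refine mul_le_mul_of_nonneg_left ?_ (sq_nonneg _)
  have h1 := hg0 (m, n)
  have h2 := hg0 (n, m)
  simp only [Prod.swap_prod_mk]
  rcases le_total m n with hp | hp
  · rw [min_eq_left hp, max_eq_right hp, hgle n m hp, mul_comm]
    exact le_add_of_nonneg_left h1
  · rw [min_eq_right hp, max_eq_left hp, hgle m n hp, mul_comm]
    exact le_add_of_nonneg_right h2

/-! ### The minimal Jacobi operator, its adjoint and its closure -/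

section JacobiOperator

variable {a b : ℕ → ℝ}

open scoped ComplexConjugate

lemma green_identity (u v : ℕ → ℂ) (N : ℕ) :
    ∑ n ∈ Finset.range (N + 1),
      (conj (jacobiAction a b u n) * v n - conj (u n) * jacobiAction a b v n) =
      a N * (conj (u (N + 1)) * v N - conj (u N) * v (N + 1)) := by
  induction N with
  | zero => simp [jacobiAction]; ring
  | succ N ih =>
    rw [Finset.sum_range_succ, ih]
    simp only [jacobiAction, map_add, map_mul, Complex.conj_ofReal]
    ring

lemma basisVec_mem_finiteVectors (n : ℕ) : basisVec n ∈ finiteVectors := by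
  change (Function.support (basisVec n : ℕ → ℂ)).Finite
  refine (Set.finite_singleton n).subset fun k hk => ?_
  by_contra h
  exact hk (by rw [basisVec_apply, if_neg (show ¬ k = n from h)])

lemma dense_finiteVectors : Dense (finiteVectors : Set EllTwo) := fun u =>
  mem_closure_of_tendsto (tendsto_sum_single u) (Eventually.of_forall fun N =>
    Submodule.sum_mem _ fun n _ => by
      rw [single_eq_smul_basisVec]
      exact Submodule.smul_mem _ _ (basisVec_mem_finiteVectors n))

lemma dense_domain_minimalJacobi : Dense ((minimalJacobi a b).domain : Set EllTwo) :=
  dense_finiteVectors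

lemma eventually_eq_zero_of_mem_finiteVectors {u : EllTwo} (hu : u ∈ finiteVectors) :
    ∀ᶠ n in atTop, u n = 0 := by
  have hu' : (Function.support (u : ℕ → ℂ)).Finite := hu
  obtain ⟨N, hN⟩ := hu'.bddAbove
  filter_upwards [eventually_gt_atTop N] with n hn
  by_contra h
  exact absurd (hN h) (not_le.mpr hn)

lemma hasSum_inner_mul (u v : EllTwo) :
    HasSum (fun n => conj (u n) * v n) (inner ℂ u v) := by
  refine (lp.hasSum_inner u v).congr_fun fun n => ?_
  simp [mul_comm]

lemma isFormalAdjoint_minimalJacobi :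
    (minimalJacobi a b).IsFormalAdjoint (minimalJacobi a b) := by
  intro x y
  have h1 := ((hasSum_inner_mul (minimalJacobi a b x) y).sub
    (hasSum_inner_mul (x : EllTwo) (minimalJacobi a b y))).tendsto_sum_nat.comp
    (tendsto_add_atTop_nat 1)
  have h2 : Tendsto (fun N => a N * (conj ((x : EllTwo) (N + 1)) * (y : EllTwo) N -
      conj ((x : EllTwo) N) * (y : EllTwo) (N + 1))) atTop (𝓝 0) := by
    refine tendsto_const_nhds.congr' ?_
    have hx := eventually_eq_zero_of_mem_finiteVectors x.2
    filter_upwards [hx, (tendsto_add_atTop_nat 1).eventually hx] with n h h'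
    simp [h, h']
  have h3 := h2.congr fun N => (green_identity (a := a) (b := b) (x : EllTwo) (y : EllTwo) N).symm
  exact sub_eq_zero.mp (tendsto_nhds_unique h1 h3)

lemma minimalJacobi_le_adjoint : minimalJacobi a b ≤ (minimalJacobi a b).adjoint :=
  isFormalAdjoint_minimalJacobi.le_adjoint dense_domain_minimalJacobi

lemma isClosable_minimalJacobi : (minimalJacobi a b).IsClosable :=
  ((minimalJacobi a b).adjoint_isClosed dense_domain_minimalJacobi).isClosable.leIsClosable
    minimalJacobi_le_adjoint

lemma graph_jacobiOperator :
    ((jacobiOperator a b).graph : Set (EllTwo × EllTwo)) = closure (minimalJacobi a b).graph := by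
  rw [jacobiOperator, ← isClosable_minimalJacobi.graph_closure_eq_closure_graph]
  rfl

lemma jacobiOperator_le_adjoint : jacobiOperator a b ≤ (minimalJacobi a b).adjoint := by
  have hc := (minimalJacobi a b).adjoint_isClosed dense_domain_minimalJacobi
  refine LinearPMap.le_of_le_graph ?_
  rw [← SetLike.coe_subset_coe, graph_jacobiOperator]
  exact closure_minimal (LinearPMap.le_graph_of_le minimalJacobi_le_adjoint) hc

/-- Pair with `basisVec n`: in Green's identity the boundary terms vanish once the cut-off passes
`n`. -/
lemma adjoint_minimalJacobi_apply (x : (minimalJacobi a b).adjoint.domain) (n : ℕ) :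
    ((minimalJacobi a b).adjoint x : ℕ → ℂ) n = jacobiAction a b (x : EllTwo) n := by
  have h1 := (minimalJacobi a b).adjoint_isFormalAdjoint dense_domain_minimalJacobi x
    ⟨basisVec n, basisVec_mem_finiteVectors n⟩
  have h2 := (hasSum_inner_mul (x : EllTwo) (minimalJacobi a b ⟨basisVec n,
    basisVec_mem_finiteVectors n⟩)).tendsto_sum_nat.comp (tendsto_add_atTop_nat 1)
  have h3 : Tendsto ((fun N => ∑ k ∈ Finset.range N, conj ((x : EllTwo) k) *
      (minimalJacobi a b ⟨basisVec n, basisVec_mem_finiteVectors n⟩ : ℕ → ℂ) k) ∘ fun N => N + 1)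
      atTop (𝓝 (conj (jacobiAction a b (x : EllTwo) n))) := by
    refine tendsto_const_nhds.congr' ?_
    filter_upwards [eventually_gt_atTop n] with N hN
    have h4 := green_identity (a := a) (b := b) (x : EllTwo) (basisVec n) N
    rw [Finset.sum_sub_distrib, basisVec_apply, basisVec_apply, if_neg (by omega),
      if_neg (by omega), mul_zero, mul_zero, sub_zero, mul_zero, sub_eq_zero] at h4
    refine Eq.trans ?_ h4
    simp only [basisVec_apply, mul_ite, mul_one, mul_zero]
    rw [Finset.sum_ite_eq', if_pos (by simp; omega)]
  have h5 := tendsto_nhds_unique h2 h3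
  rw [← h1, ← inner_conj_symm, inner_basisVec_left] at h5
  simpa using congrArg conj h5

lemma apply_eq_of_mem_graph_jacobiOperator {u v : EllTwo}
    (h : (u, v) ∈ (jacobiOperator a b).graph) (n : ℕ) : v n = jacobiAction a b u n := by
  obtain ⟨x, hx, hxv⟩ := (LinearPMap.mem_graph_iff _).mp
    (LinearPMap.le_graph_of_le jacobiOperator_le_adjoint h)
  simp only at hx hxv
  rw [← hxv, ← hx]
  exact adjoint_minimalJacobi_apply x n

/-- A sufficient condition for a vector to belong to the domain of the Jacobi operator. -/
lemma mem_graph_jacobiOperator {u v : EllTwo} (h : ∀ n, v n = jacobiAction a b u n)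
    (h₁ : Tendsto (fun n => (a n : ℂ) * u n) atTop (𝓝 0))
    (h₂ : Tendsto (fun n => (a n : ℂ) * u (n + 1)) atTop (𝓝 0)) :
    (u, v) ∈ (jacobiOperator a b).graph := by
  rw [← SetLike.mem_coe, graph_jacobiOperator]
  set x : ℕ → EllTwo := fun N => ∑ n ∈ Finset.range (N + 1), lp.single 2 n (u n) with hx
  have hxmem (N : ℕ) : x N ∈ finiteVectors := Submodule.sum_mem _ fun n _ => by
    rw [single_eq_smul_basisVec]
    exact Submodule.smul_mem _ _ (basisVec_mem_finiteVectors n)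
  have happ (w : EllTwo) (N k : ℕ) :
      ((∑ n ∈ Finset.range (N + 1), lp.single 2 n (w n) : EllTwo) : ℕ → ℂ) k =
        if k ≤ N then w k else 0 := by
    rw [lp.coeFn_sum, Finset.sum_apply]
    simp only [single_eq_smul_basisVec, lp.coeFn_smul, Pi.smul_apply, basisVec_apply, smul_eq_mul,
      mul_ite, mul_one, mul_zero]
    rw [Finset.sum_ite_eq]
    simp
  -- Truncating `u` after `N` truncates `v`, up to one error in row `N` (the missing `u (N+1)`) and
  -- one in row `N + 1` (the remaining `u N`). The two decay hypotheses make exactly these errors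
  -- vanish.
  have hT (N : ℕ) : minimalJacobi a b ⟨x N, hxmem N⟩ =
      ∑ n ∈ Finset.range (N + 1), lp.single 2 n (v n) - ((a N : ℂ) * u (N + 1)) • basisVec N +
        ((a N : ℂ) * u N) • basisVec (N + 1) := by
    apply lp.ext
    funext k
    have e : (minimalJacobi a b ⟨x N, hxmem N⟩ : ℕ → ℂ) k = jacobiAction a b (x N) k := rfl
    rw [e, lp.coeFn_add, lp.coeFn_sub, lp.coeFn_smul, lp.coeFn_smul, Pi.add_apply, Pi.sub_apply,
      happ, Pi.smul_apply, Pi.smul_apply, basisVec_apply, basisVec_apply, h]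
    cases k with
    | zero =>
      simp only [jacobiAction, hx, happ]
      rcases Nat.eq_zero_or_pos N with rfl | hN
      · simp
      · have h0 : ¬ 0 = N := by omega
        have h1 : 0 + 1 ≤ N := hN
        simp [h0, h1]
    | succ k =>
      simp only [jacobiAction, hx, happ]
      rcases lt_trichotomy (k + 1) N with hk | hk | hk
      · rw [if_pos (by omega), if_pos (by omega), if_pos (by omega), if_pos (by omega),
          if_neg (by omega), if_neg (by omega)]
        simp
      · subst hk
        simp
      · rcases Nat.eq_or_lt_of_le (Nat.lt_succ_iff.mp (by omega : N < k + 1)) with rfl | hk'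
        · simp
        · rw [if_neg (by omega), if_neg (by omega), if_neg (by omega), if_neg (by omega),
            if_neg (by omega), if_neg (by omega)]
          simp
  have hlim₁ : Tendsto x atTop (𝓝 u) := (tendsto_sum_single u).comp (tendsto_add_atTop_nat 1)
  have hsm (c : ℕ → ℂ) (i : ℕ → ℕ) (hc : Tendsto c atTop (𝓝 0)) :
      Tendsto (fun N => c N • basisVec (i N)) atTop (𝓝 0) := by
    rw [tendsto_zero_iff_norm_tendsto_zero]
    refine hc.norm.congr' (Eventually.of_forall fun N => ?_) |>.trans (by simp)
    rw [norm_smul, basisVec, lp.norm_single (by norm_num)]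
    simp
  have hlim₂ : Tendsto (fun N => minimalJacobi a b ⟨x N, hxmem N⟩) atTop (𝓝 v) := by
    simp only [hT]
    have := (((tendsto_sum_single v).comp (tendsto_add_atTop_nat 1)).sub
      (hsm _ (fun N => N) h₂)).add (hsm _ (fun N => N + 1) h₁)
    simpa using this
  exact mem_closure_of_tendsto (hlim₁.prodMk_nhds hlim₂)
    (Eventually.of_forall fun N => (minimalJacobi a b).mem_graph ⟨x N, hxmem N⟩)

end JacobiOperator

/-! ### The Green function, the resolvent and self-adjointness -/

open scoped ComplexConjugate

/-- A solution of the Jacobi equation of exactly the size of `s`. -/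
structure IsDecayingSolution (a b s : ℕ → ℝ) (z : ℂ) (u : ℕ → ℂ) : Prop where
  solves : SolvesJacobi a b z u
  isBigO : (fun n => u (n + 1)) =O[atTop] s
  isBigO_rev : s =O[atTop] fun n => u (n + 1)

lemma jacobiAction_shift (a b : ℕ → ℝ) {u : ℕ → ℂ} (h : u 0 = 0) (n : ℕ) :
    jacobiAction a b (fun k => u (k + 1)) n =
      shiftedCoeff a n * u n + b n * u (n + 1) + a n * u (n + 2) := by
  cases n with
  | zero => simp [jacobiAction, h]
  | succ n => rfl

lemma jacobiOperator_apply (a b : ℕ → ℝ) (x : (jacobiOperator a b).domain) (n : ℕ) :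
    ((jacobiOperator a b x : EllTwo) : ℕ → ℂ) n = jacobiAction a b (x : EllTwo) n :=
  apply_eq_of_mem_graph_jacobiOperator ((jacobiOperator a b).mem_graph x) n

/-- A solution of `J x = z x` in the pointwise sense is a multiple of the orthogonal
polynomials. -/
lemma exists_eq_orthPoly {a b : ℕ → ℝ} (ha : ∀ n, 0 < a n) {z : ℂ} {x : ℕ → ℂ}
    (hx : ∀ n, jacobiAction a b x n = z * x n) :
    ∃ c : ℂ, ∀ n, x n = c * orthPoly a b z (n + 1) := by
  set u : ℕ → ℂ := fun k => if k = 0 then 0 else x (k - 1) with hu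
  have hux : (fun k => u (k + 1)) = x := by funext k; simp [hu]
  have hsol : SolvesJacobi a b z u := fun n => by
    rw [← jacobiAction_shift a b (by simp [hu]), hux, hx, ← hux]
  obtain ⟨c, hc⟩ := hsol.eq_smul_orthPoly ha (by simp [hu])
  refine ⟨c, fun n => ?_⟩
  have := congrFun hc (n + 1)
  simpa [hu] using this

/-- The Green function `P (min n m) * f (max n m)` solves the inhomogeneous equation. -/
lemma jacobiAction_green {a b : ℕ → ℝ} (ha : ∀ n, 0 < a n) {z : ℂ} {u : ℕ → ℂ}
    (hu : SolvesJacobi a b z u) (m n : ℕ) :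
    jacobiAction a b (fun k => orthPoly a b z (min k m + 1) * u (max k m + 1)) n =
      z * (orthPoly a b z (min n m + 1) * u (max n m + 1)) +
        if n = m then wronskian a (orthPoly a b z) u 0 else 0 := by
  have hP := solvesJacobi_orthPoly (b := b) ha z
  set P := orthPoly a b z with hPdef
  -- In shifted indexing `G` also has an entry at `0`, which is zero because `P_{-1} = 0`; this
  -- encodes the boundary condition.
  set G : ℕ → ℂ := fun k => P (min k (m + 1)) * u (max k (m + 1)) with hG
  have hG1 (k : ℕ) : P (min k m + 1) * u (max k m + 1) = G (k + 1) := by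
    simp only [hG]
    congr 2 <;> omega
  have hlow (k : ℕ) (hk : k ≤ m + 1) : G k = P k * u (m + 1) := by
    simp only [hG]; rw [min_eq_left hk, max_eq_right hk]
  have hhigh (k : ℕ) (hk : m + 1 ≤ k) : G k = P (m + 1) * u k := by
    simp only [hG]; rw [min_eq_right hk, max_eq_left hk]
  simp only [hG1]
  rw [jacobiAction_shift a b (by rw [hlow 0 (by omega)]; simp [hPdef, orthPoly])]
  rcases lt_trichotomy n m with h | h | h
  · rw [if_neg (by omega), hlow _ (by omega), hlow _ (by omega), hlow _ (by omega)]
    linear_combination u (m + 1) * hP n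
  -- On the diagonal the two branches meet, and the mismatch is the Wronskian.
  · subst h
    rw [if_pos rfl, hlow n (by omega), hlow (n + 1) (by omega), hhigh (n + 2) (by omega),
      ← hP.wronskian_eq hu (n + 1)]
    simp only [wronskian]
    rw [show shiftedCoeff a (n + 1) = a n from rfl]
    linear_combination u (n + 1) * hP n
  · rw [if_neg (by omega), hhigh _ (by omega), hhigh _ (by omega), hhigh _ (by omega)]
    linear_combination P (m + 1) * hu n

/-- By closedness, a bounded right inverse of `J - z` on the basis vectors is a right inverse. -/
lemma mem_graph_of_basisVec {a b : ℕ → ℝ} {z : ℂ} {R : EllTwo →L[ℂ] EllTwo}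
    (h : ∀ m, (R (basisVec m), basisVec m + z • R (basisVec m)) ∈ (jacobiOperator a b).graph)
    (y : EllTwo) : (R y, y + z • R y) ∈ (jacobiOperator a b).graph := by
  have hclosed : IsClosed ((jacobiOperator a b).graph : Set (EllTwo × EllTwo)) := by
    rw [graph_jacobiOperator]
    exact isClosed_closure
  let Φ : EllTwo →L[ℂ] EllTwo × EllTwo := R.prod (ContinuousLinearMap.id ℂ EllTwo + z • R)
  refine hclosed.mem_of_tendsto ((Φ.continuous.tendsto y).comp (tendsto_sum_single y))
    (Eventually.of_forall fun N => ?_)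
  simp only [Function.comp, SetLike.mem_coe, map_sum]
  refine Submodule.sum_mem _ fun n _ => ?_
  rw [single_eq_smul_basisVec, map_smul]
  exact Submodule.smul_mem _ _ (h n)

section

variable {a b s E : ℕ → ℝ} {ϱ : ℝ} {z : ℂ} {u : ℕ → ℂ}

namespace IsDecayingSolution

lemma tendsto_mul (H : IsDecayingAnsatz a b s E ϱ) (hu : IsDecayingSolution a b s z u) :
    Tendsto (fun n => (a n : ℂ) * u (n + 1)) atTop (𝓝 0) :=
  (IsBigO.mul (IsBigO.of_bound 1 (Eventually.of_forall fun n => by simp))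
    hu.isBigO).trans_tendsto H.mul_tendsto

lemma tendsto_mul_succ (H : IsDecayingAnsatz a b s E ϱ) (hu : IsDecayingSolution a b s z u) :
    Tendsto (fun n => (a n : ℂ) * u (n + 2)) atTop (𝓝 0) :=
  (IsBigO.mul (IsBigO.of_bound 1 (Eventually.of_forall fun n => by simp))
    (hu.isBigO.comp_tendsto (tendsto_add_atTop_nat 1))).trans_tendsto H.mul_succ_tendsto

lemma summable_sq (H : IsDecayingAnsatz a b s E ϱ) (hu : IsDecayingSolution a b s z u) :
    Summable fun n => ‖u (n + 1)‖ ^ 2 :=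
  summable_of_isBigO_nat (Real.summable_nat_rpow.mpr (by linarith [H.rate_pos]))
    ((hu.isBigO.norm_left.pow 2).trans H.sq_isBigO)

lemma exists_ne_zero (H : IsDecayingAnsatz a b s E ϱ) (hu : IsDecayingSolution a b s z u) :
    ∃ n, u (n + 1) ≠ 0 := by
  obtain ⟨n, hn, h1⟩ := (hu.isBigO_rev.eq_zero_imp.and (eventually_ge_atTop 1)).exists
  exact ⟨n, fun h => H.ne_zero n h1 (hn h)⟩

lemma exists_green_operator (H : IsDecayingAnsatz a b s E ϱ) (ha : ∀ n, 0 < a n)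
    (hu : IsDecayingSolution a b s z u) (c : ℂ) :
    ∃ R : EllTwo →L[ℂ] EllTwo, ∀ n m, (R (basisVec m) : ℕ → ℂ) n =
      c * orthPoly a b z (min n m + 1) * u (max n m + 1) := by
  have hS := H.summable_sq_mul_sum_sq ha (solvesJacobi_orthPoly ha z) hu.solves hu.isBigO
    hu.isBigO_rev
  exact exists_hilbertSchmidt
    (fun n m => c * orthPoly a b z (min n m + 1) * u (max n m + 1))
    (summable_min_max (F := fun n => u (n + 1)) (P := fun n => orthPoly a b z (n + 1)) hS c)

/-- From index `m` on, the column is a multiple of the decaying solution, so the boundary terms in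
the domain criterion vanish. -/
lemma green_column_mem_graph (H : IsDecayingAnsatz a b s E ϱ) (ha : ∀ n, 0 < a n)
    (hu : IsDecayingSolution a b s z u) {ω : ℂ} (hω : wronskian a (orthPoly a b z) u 0 = ω)
    (hω0 : ω ≠ 0) {m : ℕ} {g : EllTwo}
    (hg : ∀ n, g n = ω⁻¹ * orthPoly a b z (min n m + 1) * u (max n m + 1)) :
    (g, basisVec m + z • g) ∈ (jacobiOperator a b).graph := by
  have hev (k : ℕ) (hk : m ≤ k) : g k = ω⁻¹ * orthPoly a b z (m + 1) * u (k + 1) := by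
    rw [hg, min_eq_right hk, max_eq_left hk]
  apply mem_graph_jacobiOperator
  · intro n
    have e1 : (g : ℕ → ℂ) = ω⁻¹ • fun k =>
        orthPoly a b z (min k m + 1) * u (max k m + 1) := by
      funext k
      rw [hg, Pi.smul_apply, smul_eq_mul, mul_assoc]
    rw [lp.coeFn_add, lp.coeFn_smul, Pi.add_apply, Pi.smul_apply, basisVec_apply, e1,
      jacobiAction_smul, Pi.smul_apply, Pi.smul_apply, jacobiAction_green ha hu.solves,
      smul_eq_mul, smul_eq_mul, smul_eq_mul, hω]
    split_ifs
    · rw [mul_add, inv_mul_cancel₀ hω0]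
      ring
    · ring
  · have := (hu.tendsto_mul H).const_mul (ω⁻¹ * orthPoly a b z (m + 1))
    rw [mul_zero] at this
    refine this.congr' ?_
    filter_upwards [eventually_ge_atTop m] with k hk
    rw [hev k hk]
    ring
  · have := (hu.tendsto_mul_succ H).const_mul (ω⁻¹ * orthPoly a b z (m + 1))
    rw [mul_zero] at this
    refine this.congr' ?_
    filter_upwards [eventually_ge_atTop m] with k hk
    rw [hev (k + 1) (by omega)]
    ring

/-- Such an `x` is `c P` and tends to zero, so its Wronskian with `u` vanishes; that Wronskian is
`c` times the nonzero one of `P` and `u`. -/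
lemma eq_zero_of_jacobiAction_eq (H : IsDecayingAnsatz a b s E ϱ) (ha : ∀ n, 0 < a n)
    (hu : IsDecayingSolution a b s z u) (hw : wronskian a (orthPoly a b z) u 0 ≠ 0)
    (x : EllTwo) (hx : ∀ n, jacobiAction a b x n = z * x n) : x = 0 := by
  obtain ⟨c, hc⟩ := exists_eq_orthPoly ha hx
  have hx0 : Tendsto (fun n => (c • orthPoly a b z) (n + 1)) atTop (𝓝 0) := by
    have h1 := (memlp_two_iff.mp (lp.memℓp x)).tendsto_atTop_zero
    have h2 : Tendsto (fun n => ‖x n‖) atTop (𝓝 0) := by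
      have := h1.sqrt
      simpa [Real.sqrt_sq (norm_nonneg _)] using this
    refine (tendsto_zero_iff_norm_tendsto_zero.mpr h2).congr fun n => ?_
    rw [hc]; rfl
  have h3 := H.wronskian_eq_zero ((solvesJacobi_orthPoly ha z).const_smul c) hu.solves hx0
    hu.isBigO
  have h4 : wronskian a (c • orthPoly a b z) u 0 = c * wronskian a (orthPoly a b z) u 0 := by
    simp only [wronskian, Pi.smul_apply, smul_eq_mul]; ring
  rw [h4] at h3
  have hc0 : c = 0 := (mul_eq_zero.mp h3).resolve_right hw
  apply lp.ext
  funext n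
  rw [hc, hc0, zero_mul]
  rfl

/-- If the Jost function does not vanish, then the Green function is the kernel of the
resolvent. -/
lemma exists_isResolventAt (H : IsDecayingAnsatz a b s E ϱ) (ha : ∀ n, 0 < a n)
    (hu : IsDecayingSolution a b s z u) (hw : wronskian a (orthPoly a b z) u 0 ≠ 0) :
    ∃ R : EllTwo →L[ℂ] EllTwo, IsResolventAt (jacobiOperator a b) z R ∧
      (∀ n m, (R (basisVec m) : ℕ → ℂ) n = (wronskian a (orthPoly a b z) u 0)⁻¹ *
        orthPoly a b z (min n m + 1) * u (max n m + 1)) ∧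
      ∀ x y : EllTwo, (∀ n, y n = jacobiAction a b x n) → R (y - z • x) = x := by
  obtain ⟨R, hR⟩ := hu.exists_green_operator H ha (wronskian a (orthPoly a b z) u 0)⁻¹
  have hall := mem_graph_of_basisVec fun m =>
    hu.green_column_mem_graph H ha rfl hw fun n => hR n m
  -- Only the pointwise action enters, not `x ∈ dom J`; so `R` is a left inverse on the maximal
  -- domain too, which gives self-adjointness.
  have hleft (x y : EllTwo) (hy : ∀ n, y n = jacobiAction a b x n) : R (y - z • x) = x := by
    rw [← sub_eq_zero]
    apply hu.eq_zero_of_jacobiAction_eq H ha hw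
    intro n
    have h1 := apply_eq_of_mem_graph_jacobiOperator (hall (y - z • x)) n
    rw [lp.coeFn_sub, sub_eq_add_neg, ← neg_one_smul ℂ (x : ℕ → ℂ), jacobiAction_add,
      jacobiAction_smul, Pi.add_apply, Pi.smul_apply, ← h1, ← hy]
    simp only [lp.coeFn_add, lp.coeFn_sub, lp.coeFn_smul, Pi.add_apply, Pi.sub_apply,
      Pi.smul_apply, smul_eq_mul]
    ring
  refine ⟨R, ⟨fun y => ?_, fun x => ?_⟩, hR, hleft⟩
  · obtain ⟨x, hx1, hx2⟩ := (LinearPMap.mem_graph_iff _).mp (hall y)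
    simp only at hx1 hx2
    refine ⟨hx1 ▸ x.2, ?_⟩
    have : (⟨R y, hx1 ▸ x.2⟩ : (jacobiOperator a b).domain) = x := Subtype.ext hx1.symm
    rw [this, hx2, add_sub_cancel_right]
  · exact hleft x _ (jacobiOperator_apply a b x)

/-- If the Jost function vanishes, then the Jost solution is an eigenvector. -/
lemma exists_eigenvector (H : IsDecayingAnsatz a b s E ϱ)
    (hu : IsDecayingSolution a b s z u) (h0 : u 0 = 0) :
    ∃ φ : EllTwo, (∀ n, φ n = u (n + 1)) ∧ φ ≠ 0 ∧ (φ, z • φ) ∈ (jacobiOperator a b).graph := by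
  refine ⟨⟨fun n => u (n + 1), memlp_two_iff.mpr (hu.summable_sq H)⟩, fun n => rfl, ?_, ?_⟩
  · obtain ⟨n, hn⟩ := hu.exists_ne_zero H
    intro h
    exact hn (congrFun (congrArg (fun v : EllTwo => (v : ℕ → ℂ)) h) n)
  · refine mem_graph_jacobiOperator (fun n => ?_) (hu.tendsto_mul H) (hu.tendsto_mul_succ H)
    rw [lp.coeFn_smul, Pi.smul_apply, smul_eq_mul]
    exact ((jacobiAction_shift a b h0 n).trans (hu.solves n)).symm

end IsDecayingSolution

/-- The Jacobi operator is symmetric. -/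
lemma inner_eq_of_mem_graph {x y v w : EllTwo} (hx : (x, v) ∈ (jacobiOperator a b).graph)
    (hy : (y, w) ∈ (minimalJacobi a b).adjoint.graph) : inner ℂ w x = inner ℂ y v := by
  have hcl : IsClosed {p : EllTwo × EllTwo | inner ℂ w p.1 = inner ℂ y p.2} :=
    isClosed_eq (by fun_prop) (by fun_prop)
  rw [← SetLike.mem_coe, graph_jacobiOperator] at hx
  refine closure_minimal (fun p hp => ?_) hcl hx
  obtain ⟨⟨p1, hp1⟩, h1, h2⟩ := (LinearPMap.mem_graph_iff _).mp hp
  obtain ⟨y', h3, h4⟩ := (LinearPMap.mem_graph_iff _).mp hy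
  simp only at h1 h2 h3 h4
  have := (minimalJacobi a b).adjoint_isFormalAdjoint dense_domain_minimalJacobi y' ⟨p1, hp1⟩
  rw [h3, h4, h2] at this
  rw [Set.mem_ofPred_eq, ← h1]
  exact this

lemma isFormalAdjoint_jacobiOperator :
    (jacobiOperator a b).IsFormalAdjoint (jacobiOperator a b) := fun x y =>
  inner_eq_of_mem_graph ((jacobiOperator a b).mem_graph y)
    (LinearPMap.le_graph_of_le jacobiOperator_le_adjoint ((jacobiOperator a b).mem_graph x))

lemma im_eq_zero_of_mem_graph {φ : EllTwo} (h0 : φ ≠ 0)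
    (h : (φ, z • φ) ∈ (jacobiOperator a b).graph) : z.im = 0 := by
  have := inner_eq_of_mem_graph h (LinearPMap.le_graph_of_le jacobiOperator_le_adjoint h)
  rw [inner_smul_left, inner_smul_right] at this
  have h1 : inner ℂ φ φ ≠ 0 := inner_self_ne_zero.mpr h0
  exact Complex.conj_eq_iff_im.mp (mul_right_cancel₀ h1 this)

/-- The adjoint of the minimal operator acts as the Jacobi matrix, so every vector of its domain is
in the range of `R`, hence in `dom J`. -/
lemma isSelfAdjoint_jacobiOperator_of_resolvent {R : EllTwo →L[ℂ] EllTwo}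
    (hR : IsResolventAt (jacobiOperator a b) z R)
    (hleft : ∀ x y : EllTwo, (∀ n, y n = jacobiAction a b x n) → R (y - z • x) = x) :
    IsSelfAdjoint (jacobiOperator a b) := by
  have hle : (minimalJacobi a b).adjoint.domain ≤ (jacobiOperator a b).domain := by
    intro x hx
    have := hleft x _ (adjoint_minimalJacobi_apply (a := a) (b := b) ⟨x, hx⟩)
    rw [← this]
    exact (hR.1 _).1
  have hdense : Dense ((jacobiOperator a b).domain : Set EllTwo) :=
    dense_domain_minimalJacobi.mono (minimalJacobi a b).le_closure.1
  have h1 : jacobiOperator a b ≤ (jacobiOperator a b).adjoint :=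
    isFormalAdjoint_jacobiOperator.le_adjoint hdense
  rw [LinearPMap.isSelfAdjoint_def]
  -- Since `J` extends the minimal operator, the domain of its adjoint is contained in that of the
  -- minimal operator's adjoint.
  refine (LinearPMap.eq_of_le_of_domain_eq h1 (le_antisymm h1.1 fun x hx => hle ?_)).symm
  refine LinearPMap.mem_adjoint_domain_of_exists _
    ⟨(jacobiOperator a b).adjoint ⟨x, hx⟩, fun y => ?_⟩
  have h2 := (jacobiOperator a b).adjoint_isFormalAdjoint hdense ⟨x, hx⟩
    ⟨y, (minimalJacobi a b).le_closure.1 y.2⟩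
  rw [h2]
  congr 1
  exact ((minimalJacobi a b).le_closure.2 rfl).symm

end

/-! ### Discreteness of the spectrum and conclusion -/

lemma not_finiteDimensional_ellTwo : ¬ FiniteDimensional ℂ EllTwo := fun h => by
  have ho : Orthonormal ℂ basisVec := by
    rw [orthonormal_iff_ite]
    intro i j
    rw [inner_basisVec_left, basisVec_apply]
  exact not_finite_iff_infinite.mpr (inferInstance : Infinite ℕ)
    (LinearIndependent.finite ho.linearIndependent)

lemma finiteDimensional_eigenspaceOf_jacobiOperator {a b : ℕ → ℝ} (ha : ∀ n, 0 < a n) (z : ℂ) :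
    FiniteDimensional ℂ (eigenspaceOf (jacobiOperator a b) z) := by
  by_cases h : eigenspaceOf (jacobiOperator a b) z = ⊥
  · rw [h]
    infer_instance
  · obtain ⟨φ, hφ, hφ0⟩ := (Submodule.ne_bot_iff _).mp h
    have hP (x : EllTwo) (hx : x ∈ eigenspaceOf (jacobiOperator a b) z) :
        ∃ c : ℂ, ∀ n, x n = c * orthPoly a b z (n + 1) :=
      exists_eq_orthPoly ha fun n =>
        (apply_eq_of_mem_graph_jacobiOperator (v := z • x) hx n).symm
    obtain ⟨c, hc⟩ := hP φ hφ
    have hc0 : c ≠ 0 := by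
      rintro rfl
      exact hφ0 (lp.ext (funext fun n => by rw [hc, zero_mul]; rfl))
    refine Submodule.finiteDimensional_of_le (S₂ := Submodule.span ℂ {φ}) fun x hx => ?_
    obtain ⟨d, hd⟩ := hP x hx
    refine Submodule.mem_span_singleton.mpr ⟨d / c, lp.ext (funext fun n => ?_)⟩
    rw [lp.coeFn_smul, Pi.smul_apply, hc, hd, smul_eq_mul]
    field_simp

lemma not_isEigenvalueOf_of_mem_resolventSetOf {H : Type*} [NormedAddCommGroup H]
    [InnerProductSpace ℂ H] {T : H →ₗ.[ℂ] H} {z : ℂ} (hz : z ∈ resolventSetOf T) :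
    ¬ IsEigenvalueOf T z := by
  intro hev
  obtain ⟨φ, hφ, hφ0⟩ := (Submodule.ne_bot_iff _).mp hev
  obtain ⟨x, h1, h2⟩ := (LinearPMap.mem_graph_iff T).mp (show (φ, z • φ) ∈ T.graph from hφ)
  have h3 := (isResolventAt_resolventOf hz).2 x
  simp only at h1 h2
  rw [h2, h1, sub_self, map_zero] at h3
  exact hφ0 h3.symm

/-- An infinite set of isolated real points in the plane is the range of an injective sequence. -/
lemma exists_enumeration {S : Set ℂ} (hreal : ∀ z ∈ S, z.im = 0) (hinf : S.Infinite)
    (hiso : ∀ z ∈ S, ∀ᶠ w in 𝓝[≠] z, w ∉ S) :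
    ∃ ev : ℕ → ℝ, Function.Injective ev ∧ S = Set.range fun k => (ev k : ℂ) := by
  have hd : DiscreteTopology S :=
    discreteTopology_subtype_iff.mpr fun z hz => inf_principal_eq_bot.mpr (hiso z hz)
  have hc : Countable S := TopologicalSpace.separableSpace_iff_countable.mp inferInstance
  have hi : Infinite S := hinf.to_subtype
  obtain ⟨hden⟩ := nonempty_denumerable S
  let e : S ≃ ℕ := Denumerable.eqv S
  have hre (k : ℕ) : (((e.symm k : ℂ).re : ℝ) : ℂ) = (e.symm k : ℂ) :=
    Complex.ext rfl (by simpa using (hreal _ (e.symm k).2).symm)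
  refine ⟨fun k => (e.symm k : ℂ).re, fun j k hjk => ?_, ?_⟩
  · apply e.symm.injective
    apply Subtype.ext
    rw [← hre j, ← hre k]
    exact congrArg _ hjk
  · ext z
    simp only [hre, Set.mem_range]
    exact ⟨fun hz => ⟨e ⟨z, hz⟩, by simp⟩, by rintro ⟨k, rfl⟩; exact (e.symm k).2⟩

/-- The spectral theory of the Jacobi operator, given a decaying solution that depends
analytically on the spectral parameter. -/
theorem jacobiOperator_spectral_theory {a b s E : ℕ → ℝ} {ϱ : ℝ} (ha : ∀ n, 0 < a n)
    (H : IsDecayingAnsatz a b s E ϱ) {f : ℂ → ℕ → ℂ}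
    (hf : ∀ z, IsDecayingSolution a b s z (f z)) (hΩ : Differentiable ℂ (jostFunction f)) :
    IsSelfAdjoint (jacobiOperator a b) ∧
      (∀ z, jostFunction f z ≠ 0 → z ∈ resolventSetOf (jacobiOperator a b) ∧
        ∀ n m : ℕ, n ≤ m →
          inner ℂ (basisVec m) (resolventOf (jacobiOperator a b) z (basisVec n)) =
            (jostFunction f z)⁻¹ * orthPoly a b z (n + 1) * f z (m + 1) ∧
          inner ℂ (basisVec n) (resolventOf (jacobiOperator a b) z (basisVec m)) =
            inner ℂ (basisVec m) (resolventOf (jacobiOperator a b) z (basisVec n))) ∧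
      HasDiscreteSpectrum (jacobiOperator a b) ∧
      ∃ ev : ℕ → ℝ, Function.Injective ev ∧
        spectrumOf (jacobiOperator a b) = Set.range (fun k => (ev k : ℂ)) ∧
        {μ : ℂ | IsEigenvalueOf (jacobiOperator a b) μ} = Set.range (fun k => (ev k : ℂ)) ∧
        {z : ℂ | jostFunction f z = 0} = Set.range (fun k => (ev k : ℂ)) ∧
        AnalyticOnNhd ℂ (resolventOf (jacobiOperator a b)) (Set.range (fun k => (ev k : ℂ)))ᶜ ∧
        ∀ k, MeromorphicAt (resolventOf (jacobiOperator a b)) (ev k : ℂ) ∧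
          meromorphicOrderAt (resolventOf (jacobiOperator a b)) (ev k : ℂ) < 0 := by
  set J := jacobiOperator a b with hJ
  have hw (z : ℂ) : wronskian a (orthPoly a b z) (f z) 0 = jostFunction f z :=
    wronskian_orthPoly ha (hf z).solves 0
  have hres (z : ℂ) (hz : jostFunction f z ≠ 0) :
      ∃ R : EllTwo →L[ℂ] EllTwo, IsResolventAt J z R ∧
      (∀ n m, (R (basisVec m) : ℕ → ℂ) n = (jostFunction f z)⁻¹ *
        orthPoly a b z (min n m + 1) * f z (max n m + 1)) ∧
      ∀ x y : EllTwo, (∀ n, y n = jacobiAction a b x n) → R (y - z • x) = x := by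
    have := (hf z).exists_isResolventAt H ha (by rwa [hw])
    rwa [hw] at this
  have hmem (z : ℂ) (hz : jostFunction f z ≠ 0) : z ∈ resolventSetOf J :=
    let ⟨R, hR, _⟩ := hres z hz
    ⟨R, hR⟩
  have heig (z : ℂ) (hz : jostFunction f z = 0) : IsEigenvalueOf J z ∧ z.im = 0 := by
    have h0 : f z 0 = 0 := by simpa [jostFunction] using hz
    obtain ⟨φ, -, hφ0, hφ⟩ := (hf z).exists_eigenvector H h0
    exact ⟨(Submodule.ne_bot_iff _).mpr ⟨φ, hφ, hφ0⟩, im_eq_zero_of_mem_graph hφ0 hφ⟩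
  have hev (z : ℂ) : IsEigenvalueOf J z ↔ jostFunction f z = 0 :=
    ⟨fun h => by
      by_contra hz
      exact not_isEigenvalueOf_of_mem_resolventSetOf (hmem z hz) h, fun h => (heig z h).1⟩
  have hspec (z : ℂ) : z ∈ spectrumOf J ↔ jostFunction f z = 0 :=
    ⟨fun h => by
      by_contra hz
      exact h (hmem z hz), fun h hz => not_isEigenvalueOf_of_mem_resolventSetOf hz (heig z h).1⟩
  have hreal (z : ℂ) (hz : z ∈ spectrumOf J) : z.im = 0 := (heig z ((hspec z).mp hz)).2
  -- All zeros are real, so the Jost function is not identically zero; by the identity theorem its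
  -- zeros are isolated.
  have hI : jostFunction f Complex.I ≠ 0 := fun h => by simpa using (heig _ h).2
  have hiso (z : ℂ) : ∀ᶠ w in 𝓝[≠] z, w ∈ resolventSetOf J := by
    have han : AnalyticOnNhd ℂ (jostFunction f) Set.univ := fun w _ => hΩ.analyticAt w
    have : ∀ᶠ w in 𝓝[≠] z, jostFunction f w ≠ 0 := by
      by_contra h
      have h1 : ∃ᶠ w in 𝓝[≠] z, jostFunction f w = 0 := h
      exact hI (han.eqOn_zero_of_preconnected_of_frequently_eq_zero isPreconnected_univ
        (Set.mem_univ z) h1 (Set.mem_univ Complex.I))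
    exact this.mono hmem
  have hiso' (z : ℂ) (hz : z ∈ spectrumOf J) : ∃ U ∈ 𝓝 z, U ∩ spectrumOf J = {z} := by
    refine ⟨_, mem_nhdsWithin_iff_eventually.mp (hiso z), ?_⟩
    ext w
    constructor
    · rintro ⟨h1, h2⟩
      by_contra hne
      exact h2 (h1 hne)
    · rintro rfl
      exact ⟨fun h => absurd rfl h, hz⟩
  have hsym : J.IsFormalAdjoint J := isFormalAdjoint_jacobiOperator
  have hfin (z : ℂ) (_ : z ∈ spectrumOf J) : FiniteDimensional ℂ (eigenspaceOf J z) :=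
    finiteDimensional_eigenspaceOf_jacobiOperator ha z
  have hnt : Nontrivial EllTwo := by
    refine ⟨basisVec 0, 0, fun h => ?_⟩
    have := congrFun (congrArg (fun v : EllTwo => (v : ℕ → ℂ)) h) 0
    simp [basisVec_apply] at this
  have hzero : {z : ℂ | jostFunction f z = 0} = spectrumOf J := Set.ext fun z => (hspec z).symm
  refine ⟨?_, ?_, ?_, ?_⟩
  · obtain ⟨R, hR, -, hleft⟩ := hres Complex.I hI
    exact isSelfAdjoint_jacobiOperator_of_resolvent hR hleft
  · intro z hz
    refine ⟨hmem z hz, fun n m hnm => ?_⟩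
    obtain ⟨R, hR, hker, -⟩ := hres z hz
    rw [hR.resolventOf_eq, inner_basisVec_left, inner_basisVec_left, hker, hker,
      min_eq_right hnm, max_eq_left hnm, min_eq_left hnm, max_eq_right hnm]
    exact ⟨rfl, rfl⟩
  · exact fun μ hμ => ⟨hiso' μ hμ, (hev μ).mpr ((hspec μ).mp hμ), hfin μ hμ⟩
  · obtain ⟨ev, hinj, hrange⟩ := exists_enumeration hreal
      (infinite_spectrumOf hsym hreal hfin not_finiteDimensional_ellTwo)
      (fun z _ => (hiso z).mono fun w hw h => h hw)
    refine ⟨ev, hinj, hrange, ?_, ?_, ?_, fun k => ?_⟩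
    · rw [← hrange]
      exact Set.ext fun z => (hev z).trans (hspec z).symm
    · rw [← hrange, hzero]
    · rw [← hrange]
      intro z hz
      have hz' : z ∈ resolventSetOf J := not_not.mp hz
      refine analyticAt_resolventOf ?_
      have := mem_nhdsWithin_iff_eventually.mp (hiso z)
      filter_upwards [this] with w hw
      rcases eq_or_ne w z with rfl | hne
      · exact hz'
      · exact hw hne
    · have hk : (ev k : ℂ) ∈ spectrumOf J := by
        rw [hrange]
        exact ⟨k, rfl⟩
      have hm := meromorphicAt_resolventOf hsym hreal hk (hiso' _ hk)
      exact ⟨hm, meromorphicOrderAt_resolventOf_neg hm (hiso _) ((hev _).mpr ((hspec _).mp hk))⟩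

end CriticalJacobi

theorem corollary5p9 (a b : ℕ → ℝ) (ha : ∀ n, 0 < a n) (α β γ σ τ : ℝ)
    (hσ : 3 / 2 < σ) (hγ : |γ| = 1)
    (haσ : (fun n : ℕ => a n / (n : ℝ) ^ σ - (1 + α / n)) =O[atTop]
      fun n : ℕ => ((n : ℝ) ^ 2)⁻¹)
    (hbσ : (fun n : ℕ => b n / (2 * γ * (n : ℝ) ^ σ) - (1 + β / n)) =O[atTop]
      fun n : ℕ => ((n : ℝ) ^ 2)⁻¹)
    (hτ : τ = 2 * β - 2 * α + σ) (hτ_pos : 0 < τ) :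
    IsSelfAdjoint (jacobiOperator a b) ∧
    (∃! f : ℂ → ℕ → ℂ, IsJostSolution a b σ γ τ f) ∧
    ∀ f : ℂ → ℕ → ℂ, IsJostSolution a b σ γ τ f →
      -- the Jost solution and the Jost function are entire; the latter is the Wronskian of `P`, `f`
      (∀ k, Differentiable ℂ fun z => f z k) ∧
      Differentiable ℂ (jostFunction f) ∧
      (∀ z k, wronskian a (orthPoly a b z) (f z) k = jostFunction f z) ∧
      -- the resolvent
      (∀ z, jostFunction f z ≠ 0 → z ∈ resolventSetOf (jacobiOperator a b) ∧
        ∀ n m : ℕ, n ≤ m →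
          inner ℂ (basisVec m) (resolventOf (jacobiOperator a b) z (basisVec n)) =
            (jostFunction f z)⁻¹ * orthPoly a b z (n + 1) * f z (m + 1) ∧
          inner ℂ (basisVec n) (resolventOf (jacobiOperator a b) z (basisVec m)) =
            inner ℂ (basisVec m) (resolventOf (jacobiOperator a b) z (basisVec n))) ∧
      -- the spectrum is discrete, its points are the eigenvalues, namely the zeros of `Ω`
      HasDiscreteSpectrum (jacobiOperator a b) ∧
      ∃ ev : ℕ → ℝ, Function.Injective ev ∧
        spectrumOf (jacobiOperator a b) = Set.range (fun k => (ev k : ℂ)) ∧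
        {μ : ℂ | IsEigenvalueOf (jacobiOperator a b) μ} = Set.range (fun k => (ev k : ℂ)) ∧
        {z : ℂ | jostFunction f z = 0} = Set.range (fun k => (ev k : ℂ)) ∧
        -- the resolvent is analytic, except for poles exactly at the eigenvalues
        AnalyticOnNhd ℂ (resolventOf (jacobiOperator a b)) (Set.range (fun k => (ev k : ℂ)))ᶜ ∧
        ∀ k, MeromorphicAt (resolventOf (jacobiOperator a b)) (ev k : ℂ) ∧
          meromorphicOrderAt (resolventOf (jacobiOperator a b)) (ev k : ℂ) < 0 := by
  have H := isDecayingAnsatz_ansatz hσ hγ haσ hbσ hτ hτ_pos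
  obtain ⟨f₀, hd₀, hf₀⟩ := H.exists_jost ha
  -- Uniqueness holds for each `z` separately, with no regularity in `z` assumed; hence every Jost
  -- solution inherits the analyticity of the constructed one.
  have huniq (f : ℂ → ℕ → ℂ) (hf : IsJostSolution a b σ γ τ f) : f = f₀ := funext fun z =>
    H.jost_unique ha (hf z).1 (hf₀ z).1 (hf z).2 (hf₀ z).2
  have hdec (z : ℂ) : IsDecayingSolution a b (ansatz σ γ τ) z (f₀ z) :=
    ⟨(hf₀ z).1, (H.isBigO_of_jost (hf₀ z).2).1, (H.isBigO_of_jost (hf₀ z).2).2⟩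
  have hΩ : Differentiable ℂ (jostFunction f₀) := (hd₀ 0).neg.div_const 2
  obtain ⟨h1, h2⟩ := jacobiOperator_spectral_theory ha H hdec hΩ
  refine ⟨h1, ⟨f₀, hf₀, huniq⟩, fun f hf => ?_⟩
  obtain rfl := huniq f hf
  exact ⟨hd₀, hΩ, fun z k => wronskian_orthPoly ha (hf z).1 k, h2⟩
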